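/- **Theorem 4 (Optimal correct-decoding exponent).** Let $\mathcal X,\mathcal Y$ be finite non-empty alphabets, $W(y\,|\,x)$ transition probabilities, and $R,K>0$. All logarithms are natural, $|t|^+=\max\{0,t\}$. *Channel ensemble.* A codebook $\mathcal C_n$ consists of $\lfloor e^{nR}\rfloor$ (not necessarily distinct) codewords $\mathbf x_m\in\mathcal X^n$. A channel instance consists of a cloud of $\lfloor e^{nK}\rfloor$ words of $\mathcal Y^n$ for every message $m$; all words are generated independently, each word in the cloud of $m$ by the memoryless law $\prod_i W(\cdot\,|\,x_{mi})$. The message $m$ is uniform, and the received word $\widehat{\mathbf y}$ is a uniformly chosen member of the cloud of $m$ (replicas counted). The decoder knows the codebook and the instance. $P_e(\mathcal C_n)$ is the error probability of the maximum-likelihood decoder (ties broken uniformly at random), averaged over messages and channel instances; $\overline P_e^{(n)}(P)$ is its average over codebooks whose letters are all i.i.d. with law $P$ on $\mathcal X$. *Exponents.* For a joint distribution $PU=P(x)U(y|x)$, respectively $TV=T(y)V(x|y)$, let $B=\mathbb E[-\log W(Y|X)]$ under that distribution and let $I_{PU}$ be the mutual information. Define $$E_c(R,K)=\min_{PU}\Big\{D(U\|W|P)+\big|R-I_{PU}-|B_{PU}-K|^+\big|^+\Big\},$$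 $$E_c(P,R,K)=\min_{TV}\Big\{D(TV\|PW)+\big|R-D(V\|P|T)-|B_{TV}-K|^+\big|^+\Big\},$$ with $D(U\|W|P)=\sum_{x,y}P(x)U(y|x)\log\frac{U(y|x)}{W(y|x)}$ and $D(V\|P|T)=\sum_{x,y}T(y)V(x|y)\log\frac{V(x|y)}{P(x)}$. Then both minima are attained, $E_c(R,K)=\min_P E_c(P,R,K)$ (attained as well), and the following limit exists and satisfies $$\lim_{n\to\infty}\ \min_{\mathcal C_n}\ -\tfrac1n\log\big[1-P_e(\mathcal C_n)\big]=E_c(R,K).$$ This exponent is achieved by random coding: for every $P$ with $E_c(P,R,K)=E_c(R,K)$, $$\lim_{n\to\infty}-\tfrac1n\log\big[1-\overline P_e^{(n)}(P)\big]=E_c(R,K),$$ and there are joint types $\tau_n$ with denominator $n$ on $\mathcal X\times\mathcal Y$ such that the same limit (with positive probabilities of correct decoding for all large $n$) holds if the maximum-likelihood decoder is replaced by the suboptimal decoder that chooses uniformly at random among the messages $m$ for which $(\mathbf x_m,\widehat{\mathbf y})$ has joint type $\tau_n$ and $\widehat{\mathbf y}$ occurs at least once in the cloud of $m$, and declares an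 error if there is no such message. -/

import Mathlib

open Filter Topology

noncomputable section

/-! ### Information quantities on finite alphabets (natural logarithms, values in `[-∞, ∞]`) -/

/-- `U a b` is a conditional distribution `U(b | a)`. -/
def IsKernel {α β : Type*} [Fintype β] (U : α → β → ℝ) : Prop :=
  ∀ a, U a ∈ stdSimplex ℝ β

/-- `p log (p / q)`, with `0 log (0 / q) = 0` and `p log (p / 0) = +∞` for `p ≠ 0`. -/
def klTerm (p q : ℝ) : EReal :=
  if p = 0 then 0 else if q = 0 then ⊤ else ((p * Real.log (p / q) : ℝ) : EReal)

/-- The Kullback-Leibler divergence `D(p ‖ q)`. -/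
def relEnt {α : Type*} [Fintype α] (p q : α → ℝ) : EReal :=
  ∑ a, klTerm (p a) (q a)

/-- The averaged divergence `D(V ‖ Q | T) = ∑ T(a) V(b|a) log (V(b|a) / Q(b|a))`;
in `EReal` one has `0 * ⊤ = 0`, so letters of zero probability do not contribute. -/
def condRelEnt {α β : Type*} [Fintype α] [Fintype β] (T : α → ℝ) (V Q : α → β → ℝ) : EReal :=
  ∑ a, (T a : EReal) * relEnt (V a) (Q a)

/-- `-log w`, equal to `+∞` at `w = 0`. -/
def negLog (w : ℝ) : EReal :=
  if w = 0 then ⊤ else ((-Real.log w : ℝ) : EReal)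

variable {X Y : Type*} [Fintype X] [Fintype Y]

/-- The joint distribution `P(x) U(y|x)`. -/
def jointXY (P : X → ℝ) (U : X → Y → ℝ) : X × Y → ℝ := fun z => P z.1 * U z.1 z.2

/-- The joint distribution `T(y) V(x|y)`. -/
def jointYX (T : Y → ℝ) (V : Y → X → ℝ) : X × Y → ℝ := fun z => T z.2 * V z.2 z.1

/-- `B_Q = E_Q[-log W(Y|X)]` for a joint distribution `Q` of `(X, Y)`. -/
def crossEnt (W : X → Y → ℝ) (Q : X × Y → ℝ) : EReal :=
  ∑ z, (Q z : EReal) * negLog (W z.1 z.2)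

/-- The mutual information of a pair with joint distribution `Q`: the divergence of `Q` from the
product of its marginals. -/
def mutualInfo (Q : X × Y → ℝ) : EReal :=
  relEnt Q (fun z => (∑ y, Q (z.1, y)) * ∑ x, Q (x, z.2))

/-- `D(U ‖ W | P) + |R - I_{PU} - |B_{PU} - K|⁺|⁺`. -/
def EcObj (W : X → Y → ℝ) (R K : ℝ) (P : X → ℝ) (U : X → Y → ℝ) : EReal :=
  condRelEnt P U W +
    max 0 ((R : EReal) - mutualInfo (jointXY P U) -
      max 0 (crossEnt W (jointXY P U) - (K : EReal)))

/-- `E_c(R, K)`: the minimum of `EcObj` over all distributions `P` on `X` and all conditional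
distributions `U` on `Y` given `X`. -/
def Ec (W : X → Y → ℝ) (R K : ℝ) : EReal :=
  ⨅ (P : X → ℝ) (_ : P ∈ stdSimplex ℝ X) (U : X → Y → ℝ) (_ : IsKernel U), EcObj W R K P U

/-- `D(TV ‖ PW) + |R - D(V ‖ P | T) - |B_{TV} - K|⁺|⁺`. -/
def EcPObj (W : X → Y → ℝ) (P : X → ℝ) (R K : ℝ) (T : Y → ℝ) (V : Y → X → ℝ) : EReal :=
  relEnt (jointYX T V) (jointXY P W) +
    max 0 ((R : EReal) - condRelEnt T V (fun _ => P) -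
      max 0 (crossEnt W (jointYX T V) - (K : EReal)))

/-- `E_c(P, R, K)`: the minimum of `EcPObj` over all distributions `T` on `Y` and all conditional
distributions `V` on `X` given `Y`. -/
def EcP (W : X → Y → ℝ) (P : X → ℝ) (R K : ℝ) : EReal :=
  ⨅ (T : Y → ℝ) (_ : T ∈ stdSimplex ℝ Y) (V : Y → X → ℝ) (_ : IsKernel V), EcPObj W P R K T V

/-! ### The channel ensemble -/

/-- `⌊e^{nr}⌋`: the number of messages for `r = R`, the size of a cloud for `r = K`. -/
def expSize (n : ℕ) (r : ℝ) : ℕ := ⌊Real.exp (n * r)⌋₊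

/-- A codebook of `M` codewords of length `n`; codewords of different messages may coincide. -/
abbrev Codebook (X : Type*) (n M : ℕ) : Type _ := Fin M → Fin n → X

/-- A channel instance: for each of the `M` messages a cloud of `N` words of length `n`. -/
abbrev Clouds (Y : Type*) (n M N : ℕ) : Type _ := Fin M → Fin N → Fin n → Y

/-- A decoder that knows the codebook and the channel instance: `φ C c y m` is the probability
with which it decides for message `m` on receiving `y`. With the remaining probability it
declares an error. -/
abbrev Decoder (X Y : Type*) (n M N : ℕ) : Type _ :=
  Codebook X n M → Clouds Y n M N → (Fin n → Y) → Fin M → ℝ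

/-- The probability that the instance `c` is generated for the codebook `C`: all words of all
clouds are independent, each being an output of the memoryless channel `W`. -/
def instanceProb {n M N : ℕ} (W : X → Y → ℝ) (C : Codebook X n M) (c : Clouds Y n M N) : ℝ :=
  ∏ m, ∏ j, ∏ i, W (C m i) (c m j i)

/-- The error probability of a decoder for the codebook `C`, averaged over the instances, the
equiprobable messages `m`, and the uniformly chosen member `j` of the cloud of `m`. -/
def errProb {n M N : ℕ} (W : X → Y → ℝ) (φ : Decoder X Y n M N) (C : Codebook X n M) : ℝ :=
  ∑ c : Clouds Y n M N, instanceProb W C c *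
    ((1 / (M : ℝ)) * ∑ m, (1 / (N : ℝ)) * ∑ j, (1 - φ C c (c m j) m))

/-- The average of `errProb` over codebooks all of whose letters are i.i.d. with law `P`. -/
def avgErrProb {n M N : ℕ} (W : X → Y → ℝ) (φ : Decoder X Y n M N) (P : X → ℝ) : ℝ :=
  ∑ C : Codebook X n M, (∏ m, ∏ i, P (C m i)) * errProb W φ C

open Classical in
/-- The transition probability of the instance `c`: the fraction of the cloud of `m` that
equals `y`. -/
def transProb {n M N : ℕ} (c : Clouds Y n M N) (m : Fin M) (y : Fin n → Y) : ℝ :=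
  ((Finset.univ.filter fun j => c m j = y).card : ℝ) / N

/-- The random choice of an element of `S`, uniformly; an error is declared if `S` is empty. -/
def uniformChoice {M : ℕ} (S : Finset (Fin M)) (m : Fin M) : ℝ :=
  if m ∈ S then 1 / (S.card : ℝ) else 0

open Classical in
/-- The maximum-likelihood decoder, ties being broken uniformly. -/
def mlDecoder (X Y : Type*) [Fintype Y] (n M N : ℕ) : Decoder X Y n M N := fun _ c y =>
  uniformChoice (Finset.univ.filter fun m => ∀ m', transProb c m' y ≤ transProb c m y)

open Classical in
/-- `n` times the joint type of the words `x` and `y`. -/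
def jointCount {n : ℕ} (x : Fin n → X) (y : Fin n → Y) (z : X × Y) : ℕ :=
  (Finset.univ.filter fun i => (x i, y i) = z).card

open Classical in
/-- The decoder that anticipates the single joint type `τ / n`: it chooses uniformly among the
messages whose codeword has this joint type with the received word `y` and whose cloud contains
`y` at least once, whatever the number of replicas of `y`. -/
def typeDecoder {n M N : ℕ} (τ : X × Y → ℕ) : Decoder X Y n M N := fun C c y =>
  uniformChoice (Finset.univ.filter fun m => jointCount (C m) y = τ ∧ ∃ j, c m j = y)

/-- `P_e(C)`: the average error probability of maximum-likelihood decoding with clouds of size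
`⌊e^{nK}⌋`. -/
def Pe {n M : ℕ} (W : X → Y → ℝ) (K : ℝ) (C : Codebook X n M) : ℝ :=
  errProb W (mlDecoder X Y n M (expSize n K)) C

/-- The error probability of maximum-likelihood decoding averaged also over i.i.d. random
codebooks of `⌊e^{nR}⌋` codewords. -/
def PeRandom (W : X → Y → ℝ) (R K : ℝ) (P : X → ℝ) (n : ℕ) : ℝ :=
  avgErrProb W (mlDecoder X Y n (expSize n R) (expSize n K)) P

/-- The same average for the decoder that anticipates the joint type `τ / n`. -/
def PeRandomType (W : X → Y → ℝ) (R K : ℝ) (P : X → ℝ) (n : ℕ) (τ : X × Y → ℕ) : ℝ :=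
  avgErrProb W (typeDecoder τ : Decoder X Y n (expSize n R) (expSize n K)) P

/-- `-(1/n) log p`. -/
def expo (n : ℕ) (p : ℝ) : ℝ := -(1 / (n : ℝ)) * Real.log p

end

noncomputable section

set_option linter.unusedSectionVars false

/-! ### Real-valued forms of the exponents -/

/-! Both objectives are finite exactly at joint distributions `Q` dominated by the channel (by `PW`
in the case of `EcPObj`). There they are continuous entropy expressions in `Q`, so compactness gives
the minima. At the same `Q`, passing from the first objective to the second adds `D(Q_X ‖ P)`
outside the outer positive part and subtracts it inside. The value cannot decrease, and it is
unchanged for `P = Q_X`; this is `isLeast_EcP`.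

Converse: with `M` messages and clouds of size `N`, the probability of correct decoding is `1/(MN)`
times the expected number of correctly decoded replicas. It splits over polynomially many joint
types of codeword and received word. For one type there are two bounds. Ignoring the competition
between messages leaves the expected number of replicas and costs `D(U ‖ W | P)`. Alternatively, the
decoding weights for a given `y` sum to at most one, so `y` contributes at most the largest replica
count among `M` clouds, in expectation of order `nR + N exp(-nB)`, and there are at most
`exp(nH(Y))` such `y`. The better of the two bounds is the outer positive part; the inner one
records which of `1` and `N exp(-nB)` dominates. This is `typeContribution_div_le`.

Achievability: a replica of the anticipated type is decoded correctly with probability one over one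
plus the number of competing candidates. Competitors are independent of the sent message, so a
convexity bound gives `typeProb / (1 + μ)`, with `μ` a bound on the expected number of candidates
(`typeProb_div_le_one_sub_avgErrProb`). The anticipated type is not obtained by rounding: it is a
most likely type under i.i.d. sampling from the minimizer `Q`. By pigeonhole it has polynomially
large probability, which forces its divergence from `Q` to vanish (`tendsto_typeDist`). A change of
measure from `Q` to `PW` and continuity then give the exponent.

Maximum likelihood is at least as good as the type decoder, and the best codebook at least as good
as the average one, so `exists_exponent_bounds` squeezes all the limits at once. -/

theorem ereal_coe_sum {α : Type*} (s : Finset α) (f : α → ℝ) :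
    ((∑ a ∈ s, f a : ℝ) : EReal) = ∑ a ∈ s, (f a : EReal) := by
  classical
  induction s using Finset.induction_on with
  | empty => simp
  | insert a s ha ih => rw [Finset.sum_insert ha, Finset.sum_insert ha, EReal.coe_add, ih]

theorem ereal_coe_max (a b : ℝ) : ((max a b : ℝ) : EReal) = max (a : EReal) b :=
  EReal.coe_strictMono.monotone.map_max

theorem ereal_sum_ne_bot {α : Type*} (s : Finset α) (f : α → EReal) (h : ∀ a ∈ s, f a ≠ ⊥) :
    ∑ a ∈ s, f a ≠ ⊥ := by
  classical
  induction s using Finset.induction_on with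
  | empty => simp
  | insert a s ha ih =>
    rw [Finset.sum_insert ha, EReal.add_ne_bot_iff]
    exact ⟨h a (Finset.mem_insert_self a s), ih fun b hb => h b (Finset.mem_insert_of_mem hb)⟩

theorem ereal_sum_eq_top {α : Type*} [Fintype α] (f : α → EReal) (h : ∀ a, f a ≠ ⊥)
    (a : α) (ha : f a = ⊤) : ∑ a, f a = ⊤ := by
  classical
  rw [← Finset.add_sum_erase _ _ (Finset.mem_univ a), ha]
  exact EReal.top_add_of_ne_bot (ereal_sum_ne_bot _ _ fun b _ => h b)

theorem klTerm_of_ac {p q : ℝ} (h : p ≠ 0 → q ≠ 0) :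
    klTerm p q = ((p * Real.log (p / q) : ℝ) : EReal) := by
  unfold klTerm
  by_cases hp : p = 0
  · simp [hp]
  · simp [hp, h hp]

theorem klTerm_ne_bot (p q : ℝ) : klTerm p q ≠ ⊥ := by
  unfold klTerm
  split_ifs
  · simp
  · simp
  · exact EReal.coe_ne_bot _

theorem relEnt_of_ac {α : Type*} [Fintype α] {p q : α → ℝ} (h : ∀ a, p a ≠ 0 → q a ≠ 0) :
    relEnt p q = ((∑ a, p a * Real.log (p a / q a) : ℝ) : EReal) := by
  rw [ereal_coe_sum]
  exact Finset.sum_congr rfl fun a _ => klTerm_of_ac (h a)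

theorem relEnt_ne_bot {α : Type*} [Fintype α] (p q : α → ℝ) : relEnt p q ≠ ⊥ :=
  ereal_sum_ne_bot _ _ fun _ _ => klTerm_ne_bot _ _

theorem relEnt_eq_top {α : Type*} [Fintype α] {p q : α → ℝ} (a : α) (hp : p a ≠ 0)
    (hq : q a = 0) : relEnt p q = ⊤ :=
  ereal_sum_eq_top _ (fun _ => klTerm_ne_bot _ _) a (by simp [klTerm, hp, hq])

theorem condRelEnt_of_ac {α β : Type*} [Fintype α] [Fintype β] {T : α → ℝ} {V Q : α → β → ℝ}
    (h : ∀ a b, T a ≠ 0 → V a b ≠ 0 → Q a b ≠ 0) :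
    condRelEnt T V Q = ((∑ a, T a * ∑ b, V a b * Real.log (V a b / Q a b) : ℝ) : EReal) := by
  rw [ereal_coe_sum]
  refine Finset.sum_congr rfl fun a _ => ?_
  by_cases ha : T a = 0
  · simp [ha]
  · rw [relEnt_of_ac fun b => h a b ha, EReal.coe_mul]

theorem condRelEnt_eq_top {α β : Type*} [Fintype α] [Fintype β] {T : α → ℝ} {V Q : α → β → ℝ}
    (hT : ∀ a, 0 ≤ T a) (a : α) (b : β) (ha : T a ≠ 0) (hV : V a b ≠ 0) (hQ : Q a b = 0) :
    condRelEnt T V Q = ⊤ := by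
  refine ereal_sum_eq_top _ (fun a' => ?_) a ?_
  · rcases (hT a').eq_or_lt with h | h
    · simp [← h]
    · rw [Ne, EReal.mul_eq_bot]
      simp [relEnt_ne_bot, h, h.not_gt]
  · rw [relEnt_eq_top b hV hQ, EReal.coe_mul_top_of_pos ((hT a).lt_of_ne' ha)]

variable {X Y : Type*} [Fintype X] [Fintype Y]

/-- `∑ p log p`. -/
def negEntropy {α : Type*} [Fintype α] (p : α → ℝ) : ℝ := ∑ a, p a * Real.log (p a)

/-- The first marginal. -/
def margX (Q : X × Y → ℝ) (x : X) : ℝ := ∑ y, Q (x, y)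

/-- The second marginal. -/
def margY (Q : X × Y → ℝ) (y : Y) : ℝ := ∑ x, Q (x, y)

/-- The expectation of `log f`. -/
def expLog {α : Type*} [Fintype α] (f Q : α → ℝ) : ℝ := ∑ z, Q z * Real.log (f z)

/-- The objective of `Ec` as a function of the joint distribution, for distributions dominated
by the channel. -/
def jointObj (W : X → Y → ℝ) (R K : ℝ) (Q : X × Y → ℝ) : ℝ :=
  negEntropy Q - negEntropy (margX Q) - expLog (fun z => W z.1 z.2) Q +
    max 0 (R - (negEntropy Q - negEntropy (margX Q) - negEntropy (margY Q)) -
      max 0 (-expLog (fun z => W z.1 z.2) Q - K))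

/-- The objective of `EcP` as a function of the joint distribution, for distributions dominated
by `P(x) W(y|x)`. -/
def jointObjP (W : X → Y → ℝ) (P : X → ℝ) (R K : ℝ) (Q : X × Y → ℝ) : ℝ :=
  negEntropy Q - expLog (fun z => P z.1) Q - expLog (fun z => W z.1 z.2) Q +
    max 0 (R - (negEntropy Q - negEntropy (margY Q) - expLog (fun z => P z.1) Q) -
      max 0 (-expLog (fun z => W z.1 z.2) Q - K))

theorem expLog_margX (Q : X × Y → ℝ) :
    expLog (fun z => margX Q z.1) Q = negEntropy (margX Q) := by
  unfold expLog negEntropy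
  rw [Fintype.sum_prod_type]
  exact Finset.sum_congr rfl fun x _ =>
    (Finset.sum_mul Finset.univ (fun y => Q (x, y)) (Real.log (margX Q x))).symm

theorem expLog_margY (Q : X × Y → ℝ) :
    expLog (fun z => margY Q z.2) Q = negEntropy (margY Q) := by
  unfold expLog negEntropy
  rw [Fintype.sum_prod_type_right]
  exact Finset.sum_congr rfl fun y _ =>
    (Finset.sum_mul Finset.univ (fun x => Q (x, y)) (Real.log (margY Q y))).symm

theorem margX_pos {Q : X × Y → ℝ} (hQ : ∀ z, 0 ≤ Q z) {z : X × Y} (hz : Q z ≠ 0) :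
    0 < margX Q z.1 :=
  ((hQ z).lt_of_ne' hz).trans_le
    (Finset.single_le_sum (f := fun y => Q (z.1, y)) (fun _ _ => hQ _) (Finset.mem_univ z.2))

theorem margY_pos {Q : X × Y → ℝ} (hQ : ∀ z, 0 ≤ Q z) {z : X × Y} (hz : Q z ≠ 0) :
    0 < margY Q z.2 :=
  ((hQ z).lt_of_ne' hz).trans_le
    (Finset.single_le_sum (f := fun x => Q (x, z.2)) (fun _ _ => hQ _) (Finset.mem_univ z.1))

theorem crossEnt_of_ac {W : X → Y → ℝ} {Q : X × Y → ℝ} (h : ∀ z, Q z ≠ 0 → W z.1 z.2 ≠ 0) :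
    crossEnt W Q = ((-expLog (fun z => W z.1 z.2) Q : ℝ) : EReal) := by
  unfold crossEnt expLog
  rw [← Finset.sum_neg_distrib, ereal_coe_sum]
  refine Finset.sum_congr rfl fun z _ => ?_
  by_cases hz : Q z = 0
  · simp [hz]
  · rw [negLog, if_neg (h z hz), ← EReal.coe_mul, mul_neg]

theorem sum_mul_log_div_mul {α : Type*} [Fintype α] {Q f g : α → ℝ}
    (hf : ∀ z, Q z ≠ 0 → f z ≠ 0) (hg : ∀ z, Q z ≠ 0 → g z ≠ 0) :
    ∑ z, Q z * Real.log (Q z / (f z * g z)) = negEntropy Q - expLog f Q - expLog g Q := by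
  unfold negEntropy expLog
  rw [← Finset.sum_sub_distrib, ← Finset.sum_sub_distrib]
  refine Finset.sum_congr rfl fun z _ => ?_
  by_cases hz : Q z = 0
  · simp [hz]
  · rw [Real.log_div hz (mul_ne_zero (hf z hz) (hg z hz)), Real.log_mul (hf z hz) (hg z hz)]
    ring

theorem mutualInfo_eq {Q : X × Y → ℝ} (hQ : ∀ z, 0 ≤ Q z) :
    mutualInfo Q =
      ((negEntropy Q - negEntropy (margX Q) - negEntropy (margY Q) : ℝ) : EReal) := by
  have hx : ∀ z, Q z ≠ 0 → margX Q z.1 ≠ 0 := fun z hz => (margX_pos hQ hz).ne'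
  have hy : ∀ z, Q z ≠ 0 → margY Q z.2 ≠ 0 := fun z hz => (margY_pos hQ hz).ne'
  rw [← expLog_margX, ← expLog_margY, ← sum_mul_log_div_mul hx hy]
  exact relEnt_of_ac fun z hz => mul_ne_zero (hx z hz) (hy z hz)

theorem margX_jointXY (P : X → ℝ) {U : X → Y → ℝ} (hU : IsKernel U) :
    margX (jointXY P U) = P := by
  ext x
  simp only [margX, jointXY]
  rw [← Finset.mul_sum, (hU x).2, mul_one]

theorem margY_jointYX (T : Y → ℝ) {V : Y → X → ℝ} (hV : IsKernel V) :
    margY (jointYX T V) = T := by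
  ext y
  simp only [margY, jointYX]
  rw [← Finset.mul_sum, (hV y).2, mul_one]

theorem jointXY_mem {P : X → ℝ} (hP : P ∈ stdSimplex ℝ X) {U : X → Y → ℝ} (hU : IsKernel U) :
    jointXY P U ∈ stdSimplex ℝ (X × Y) := by
  refine ⟨fun z => mul_nonneg (hP.1 _) ((hU _).1 _), ?_⟩
  rw [Fintype.sum_prod_type, ← hP.2]
  exact Finset.sum_congr rfl fun x _ => congrFun (margX_jointXY P hU) x

theorem jointYX_mem {T : Y → ℝ} (hT : T ∈ stdSimplex ℝ Y) {V : Y → X → ℝ} (hV : IsKernel V) :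
    jointYX T V ∈ stdSimplex ℝ (X × Y) := by
  refine ⟨fun z => mul_nonneg (hT.1 _) ((hV _).1 _), ?_⟩
  rw [Fintype.sum_prod_type_right, ← hT.2]
  exact Finset.sum_congr rfl fun y _ => congrFun (margY_jointYX T hV) y

/-- Domination makes every summand finite; the conditional divergence is brought to entropy form by
writing `U` as the joint law over its first marginal. -/
theorem EcObj_of_ac {W : X → Y → ℝ} (R K : ℝ) {P : X → ℝ} (hP : P ∈ stdSimplex ℝ X)
    {U : X → Y → ℝ} (hU : IsKernel U) (h : ∀ z, jointXY P U z ≠ 0 → W z.1 z.2 ≠ 0) :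
    EcObj W R K P U = ((jointObj W R K (jointXY P U) : ℝ) : EReal) := by
  have hD : condRelEnt P U W = ((negEntropy (jointXY P U) - negEntropy (margX (jointXY P U)) -
      expLog (fun z => W z.1 z.2) (jointXY P U) : ℝ) : EReal) := by
    rw [condRelEnt_of_ac fun a b ha hb => h (a, b) (mul_ne_zero ha hb), ← expLog_margX,
      ← sum_mul_log_div_mul (fun z hz => (margX_pos (jointXY_mem hP hU).1 hz).ne') h,
      margX_jointXY P hU, Fintype.sum_prod_type]
    congr 1
    refine Finset.sum_congr rfl fun x _ => ?_
    rw [Finset.mul_sum]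
    refine Finset.sum_congr rfl fun y _ => ?_
    by_cases hx : P x = 0
    · simp [hx, jointXY]
    · rw [jointXY, mul_div_mul_left _ _ hx, mul_assoc]
  rw [EcObj, hD, mutualInfo_eq (jointXY_mem hP hU).1, crossEnt_of_ac h, jointObj]
  simp only [EReal.coe_add, ereal_coe_max, EReal.coe_sub, EReal.coe_zero]

/-- The divergence is `⊤`, and the positive part is at least `0`, so the indeterminate sum `⊤ + ⊥`
cannot occur. -/
theorem EcObj_eq_top {W : X → Y → ℝ} (R K : ℝ) {P : X → ℝ} (hP : P ∈ stdSimplex ℝ X)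
    {U : X → Y → ℝ} (h : ¬ ∀ z, jointXY P U z ≠ 0 → W z.1 z.2 ≠ 0) :
    EcObj W R K P U = ⊤ := by
  push Not at h
  obtain ⟨z, hz, hW⟩ := h
  rw [EcObj, condRelEnt_eq_top hP.1 z.1 z.2 (left_ne_zero_of_mul hz) (right_ne_zero_of_mul hz) hW]
  exact EReal.top_add_of_ne_bot (EReal.bot_lt_zero.trans_le (le_max_left _ _)).ne'

theorem EcPObj_of_ac {W : X → Y → ℝ} {P : X → ℝ} (R K : ℝ)
    {T : Y → ℝ} (hT : T ∈ stdSimplex ℝ Y) {V : Y → X → ℝ} (hV : IsKernel V)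
    (h : ∀ z, jointYX T V z ≠ 0 → jointXY P W z ≠ 0) :
    EcPObj W P R K T V = ((jointObjP W P R K (jointYX T V) : ℝ) : EReal) := by
  have hP : ∀ z, jointYX T V z ≠ 0 → P z.1 ≠ 0 := fun z hz => left_ne_zero_of_mul (h z hz)
  have hW : ∀ z, jointYX T V z ≠ 0 → W z.1 z.2 ≠ 0 := fun z hz => right_ne_zero_of_mul (h z hz)
  have hD : condRelEnt T V (fun _ => P) = ((negEntropy (jointYX T V) -
      negEntropy (margY (jointYX T V)) - expLog (fun z => P z.1) (jointYX T V) : ℝ) : EReal) := by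
    rw [condRelEnt_of_ac fun a b ha hb => hP (b, a) (mul_ne_zero ha hb), ← expLog_margY,
      ← sum_mul_log_div_mul (fun z hz => (margY_pos (jointYX_mem hT hV).1 hz).ne') hP,
      margY_jointYX T hV, Fintype.sum_prod_type_right]
    congr 1
    refine Finset.sum_congr rfl fun x _ => ?_
    rw [Finset.mul_sum]
    refine Finset.sum_congr rfl fun y _ => ?_
    by_cases hx : T x = 0
    · simp [hx, jointYX]
    · rw [jointYX, mul_div_mul_left _ _ hx, mul_assoc]
  have hR : relEnt (jointYX T V) (jointXY P W) = ((negEntropy (jointYX T V) -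
      expLog (fun z => P z.1) (jointYX T V) -
      expLog (fun z => W z.1 z.2) (jointYX T V) : ℝ) : EReal) := by
    rw [relEnt_of_ac h, ← sum_mul_log_div_mul hP hW]
    rfl
  rw [EcPObj, hD, hR, crossEnt_of_ac hW, jointObjP]
  simp only [EReal.coe_add, ereal_coe_max, EReal.coe_sub, EReal.coe_zero]

theorem EcPObj_eq_top {W : X → Y → ℝ} {P : X → ℝ} (R K : ℝ) {T : Y → ℝ} {V : Y → X → ℝ}
    (h : ¬ ∀ z, jointYX T V z ≠ 0 → jointXY P W z ≠ 0) :
    EcPObj W P R K T V = ⊤ := by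
  push Not at h
  obtain ⟨z, hz, hW⟩ := h
  rw [EcPObj, relEnt_eq_top z hz hW]
  exact EReal.top_add_of_ne_bot (EReal.bot_lt_zero.trans_le (le_max_left _ _)).ne'

/-! ### Disintegration of joint distributions -/

theorem margX_mem {Q : X × Y → ℝ} (hQ : Q ∈ stdSimplex ℝ (X × Y)) : margX Q ∈ stdSimplex ℝ X :=
  ⟨fun _ => Finset.sum_nonneg fun _ _ => hQ.1 _, by rw [← hQ.2, Fintype.sum_prod_type]; rfl⟩

theorem margY_mem {Q : X × Y → ℝ} (hQ : Q ∈ stdSimplex ℝ (X × Y)) : margY Q ∈ stdSimplex ℝ Y :=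
  ⟨fun _ => Finset.sum_nonneg fun _ _ => hQ.1 _, by rw [← hQ.2, Fintype.sum_prod_type_right]; rfl⟩

theorem exists_jointXY_eq {W : X → Y → ℝ} (hW : IsKernel W) {Q : X × Y → ℝ}
    (hQ : Q ∈ stdSimplex ℝ (X × Y)) : ∃ U : X → Y → ℝ, IsKernel U ∧ jointXY (margX Q) U = Q := by
  classical
  -- On letters of zero mass the kernel is irrelevant to the joint law but must still be a
  -- distribution; `W x` serves as the default.
  refine ⟨fun x => if margX Q x = 0 then W x else fun y => Q (x, y) / margX Q x, fun x => ?_, ?_⟩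
  · by_cases hx : margX Q x = 0
    · simpa only [if_pos hx] using hW x
    · simp only [if_neg hx]
      refine ⟨fun y => div_nonneg (hQ.1 _) ((margX_mem hQ).1 x), ?_⟩
      rw [← Finset.sum_div]
      exact div_self hx
  · ext ⟨x, y⟩
    by_cases hx : margX Q x = 0
    · have := (Finset.sum_eq_zero_iff_of_nonneg (fun y _ => hQ.1 (x, y))).1 hx y
        (Finset.mem_univ y)
      simp [jointXY, hx, this]
    · simp only [jointXY, if_neg hx]
      exact mul_div_cancel₀ _ hx

theorem exists_jointYX_eq {P : X → ℝ} (hP : P ∈ stdSimplex ℝ X) {Q : X × Y → ℝ}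
    (hQ : Q ∈ stdSimplex ℝ (X × Y)) : ∃ V : Y → X → ℝ, IsKernel V ∧ jointYX (margY Q) V = Q := by
  classical
  refine ⟨fun y => if margY Q y = 0 then P else fun x => Q (x, y) / margY Q y, fun y => ?_, ?_⟩
  · by_cases hy : margY Q y = 0
    · simpa only [if_pos hy] using hP
    · simp only [if_neg hy]
      refine ⟨fun x => div_nonneg (hQ.1 _) ((margY_mem hQ).1 y), ?_⟩
      rw [← Finset.sum_div]
      exact div_self hy
  · ext ⟨x, y⟩
    by_cases hy : margY Q y = 0
    · have := (Finset.sum_eq_zero_iff_of_nonneg (fun x _ => hQ.1 (x, y))).1 hy x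
        (Finset.mem_univ x)
      simp [jointYX, hy, this]
    · simp only [jointYX, if_neg hy]
      exact mul_div_cancel₀ _ hy

/-! ### Attainment of the minima -/

theorem continuous_negEntropy {α : Type*} [Fintype α] :
    Continuous (negEntropy : (α → ℝ) → ℝ) :=
  continuous_finsetSum _ fun a _ => Real.continuous_mul_log.comp (continuous_apply a)

theorem continuous_expLog {α : Type*} [Fintype α] (f : α → ℝ) : Continuous (expLog f) := by
  unfold expLog
  fun_prop

theorem continuous_margX : Continuous (margX : (X × Y → ℝ) → X → ℝ) := by
  unfold margX
  fun_prop

theorem continuous_margY : Continuous (margY : (X × Y → ℝ) → Y → ℝ) := by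
  unfold margY
  fun_prop

/-- Continuity needs no domination: `t log t` is continuous at `0`, and `expLog` is linear in `Q`
because `Real.log 0 = 0`. -/
theorem continuous_jointObj (W : X → Y → ℝ) (R K : ℝ) : Continuous (jointObj W R K) := by
  have h1 : Continuous fun Q : X × Y → ℝ => negEntropy Q := continuous_negEntropy
  have h2 : Continuous fun Q : X × Y → ℝ => negEntropy (margX Q) :=
    continuous_negEntropy.comp continuous_margX
  have h3 : Continuous fun Q : X × Y → ℝ => negEntropy (margY Q) :=
    continuous_negEntropy.comp continuous_margY
  have h4 : Continuous fun Q : X × Y → ℝ => expLog (fun z => W z.1 z.2) Q := continuous_expLog _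
  unfold jointObj
  fun_prop

theorem continuous_jointObjP (W : X → Y → ℝ) (P : X → ℝ) (R K : ℝ) :
    Continuous (jointObjP W P R K) := by
  have h1 : Continuous fun Q : X × Y → ℝ => negEntropy Q := continuous_negEntropy
  have h2 : Continuous fun Q : X × Y → ℝ => expLog (fun z => P z.1) Q := continuous_expLog _
  have h3 : Continuous fun Q : X × Y → ℝ => negEntropy (margY Q) :=
    continuous_negEntropy.comp continuous_margY
  have h4 : Continuous fun Q : X × Y → ℝ => expLog (fun z => W z.1 z.2) Q := continuous_expLog _
  unfold jointObjP
  fun_prop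

/-- The distributions dominated by `f`. -/
def dominatedBy {α : Type*} [Fintype α] (f : α → ℝ) : Set (α → ℝ) :=
  {Q | Q ∈ stdSimplex ℝ α ∧ ∀ z, Q z ≠ 0 → f z ≠ 0}

/-- The support condition is closed, since it only sets to zero the coordinates where `f` vanishes.
-/
theorem isCompact_dominatedBy {α : Type*} [Fintype α] (f : α → ℝ) :
    IsCompact (dominatedBy f) := by
  have : dominatedBy f = stdSimplex ℝ α ∩ ⋂ z ∈ {z | f z = 0}, {Q : α → ℝ | Q z = 0} := by
    ext Q
    simp only [dominatedBy, Set.mem_ofPred_eq, Set.mem_inter_iff, Set.mem_iInter]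
    exact and_congr_right fun _ => forall_congr' fun z => not_imp_not
  rw [this]
  refine (isCompact_stdSimplex ℝ α).inter_right ?_
  exact isClosed_biInter fun z _ => isClosed_eq (continuous_apply z) continuous_const

theorem exists_mem_stdSimplex [Nonempty X] : ∃ P : X → ℝ, P ∈ stdSimplex ℝ X := by
  classical
  exact ⟨_, single_mem_stdSimplex ℝ (Classical.arbitrary X)⟩

theorem jointXY_mem_dominatedBy {W : X → Y → ℝ} (hW : IsKernel W) {P : X → ℝ}
    (hP : P ∈ stdSimplex ℝ X) : jointXY P W ∈ dominatedBy (jointXY P W) :=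
  ⟨jointXY_mem hP hW, fun _ h => h⟩

theorem dominatedBy_jointXY_subset (W : X → Y → ℝ) (P : X → ℝ) :
    dominatedBy (jointXY P W) ⊆ dominatedBy fun z => W z.1 z.2 :=
  fun _ hQ => ⟨hQ.1, fun z hz => right_ne_zero_of_mul (hQ.2 z hz)⟩

theorem exists_jointObj_min [Nonempty X] {W : X → Y → ℝ} (hW : IsKernel W) (R K : ℝ) :
    ∃ Q ∈ dominatedBy fun z : X × Y => W z.1 z.2,
      ∀ Q' ∈ dominatedBy fun z : X × Y => W z.1 z.2, jointObj W R K Q ≤ jointObj W R K Q' := by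
  obtain ⟨P, hP⟩ := exists_mem_stdSimplex (X := X)
  exact (isCompact_dominatedBy _).exists_isMinOn
    ⟨_, dominatedBy_jointXY_subset W P (jointXY_mem_dominatedBy hW hP)⟩
    (continuous_jointObj W R K).continuousOn

theorem exists_jointObjP_min {W : X → Y → ℝ} (hW : IsKernel W) {P : X → ℝ}
    (hP : P ∈ stdSimplex ℝ X) (R K : ℝ) :
    ∃ Q ∈ dominatedBy (jointXY P W),
      ∀ Q' ∈ dominatedBy (jointXY P W), jointObjP W P R K Q ≤ jointObjP W P R K Q' :=
  (isCompact_dominatedBy _).exists_isMinOn ⟨_, jointXY_mem_dominatedBy hW hP⟩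
    (continuous_jointObjP W P R K).continuousOn

/-- Undominated pairs have objective `⊤`, and every dominated joint law disintegrates into a pair
`(P, U)`; the infimum is therefore a real minimum over joint laws. -/
theorem Ec_eq_of_isMin {W : X → Y → ℝ} (hW : IsKernel W) (R K : ℝ) {Q : X × Y → ℝ}
    (hQ : Q ∈ dominatedBy fun z : X × Y => W z.1 z.2)
    (hmin : ∀ Q' ∈ dominatedBy fun z : X × Y => W z.1 z.2, jointObj W R K Q ≤ jointObj W R K Q') :
    Ec W R K = ((jointObj W R K Q : ℝ) : EReal) ∧
      ∃ P ∈ stdSimplex ℝ X, ∃ U : X → Y → ℝ, IsKernel U ∧ EcObj W R K P U = Ec W R K := by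
  obtain ⟨U, hU, hUQ⟩ := exists_jointXY_eq hW hQ.1
  have hobj : EcObj W R K (margX Q) U = ((jointObj W R K Q : ℝ) : EReal) := by
    rw [EcObj_of_ac R K (margX_mem hQ.1) hU (by rw [hUQ]; exact hQ.2), hUQ]
  have hE : Ec W R K = ((jointObj W R K Q : ℝ) : EReal) := by
    refine le_antisymm ?_ ?_
    · rw [← hobj]
      exact iInf_le_of_le _ (iInf_le_of_le (margX_mem hQ.1) (iInf_le_of_le U (iInf_le _ hU)))
    · refine le_iInf fun P => le_iInf fun hP => le_iInf fun U' => le_iInf fun hU' => ?_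
      by_cases h : ∀ z, jointXY P U' z ≠ 0 → W z.1 z.2 ≠ 0
      · rw [EcObj_of_ac R K hP hU' h, EReal.coe_le_coe_iff]
        exact hmin _ ⟨jointXY_mem hP hU', h⟩
      · rw [EcObj_eq_top R K hP h]
        exact le_top
  exact ⟨hE, margX Q, margX_mem hQ.1, U, hU, by rw [hobj, hE]⟩

theorem EcP_eq_of_isMin {W : X → Y → ℝ} {P : X → ℝ}
    (hP : P ∈ stdSimplex ℝ X) (R K : ℝ) {Q : X × Y → ℝ} (hQ : Q ∈ dominatedBy (jointXY P W))
    (hmin : ∀ Q' ∈ dominatedBy (jointXY P W), jointObjP W P R K Q ≤ jointObjP W P R K Q') :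
    EcP W P R K = ((jointObjP W P R K Q : ℝ) : EReal) ∧
      ∃ T ∈ stdSimplex ℝ Y, ∃ V : Y → X → ℝ, IsKernel V ∧ EcPObj W P R K T V = EcP W P R K := by
  obtain ⟨V, hV, hVQ⟩ := exists_jointYX_eq hP hQ.1
  have hobj : EcPObj W P R K (margY Q) V = ((jointObjP W P R K Q : ℝ) : EReal) := by
    rw [EcPObj_of_ac R K (margY_mem hQ.1) hV (by rw [hVQ]; exact hQ.2), hVQ]
  have hE : EcP W P R K = ((jointObjP W P R K Q : ℝ) : EReal) := by
    refine le_antisymm ?_ ?_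
    · rw [← hobj]
      exact iInf_le_of_le _ (iInf_le_of_le (margY_mem hQ.1) (iInf_le_of_le V (iInf_le _ hV)))
    · refine le_iInf fun T => le_iInf fun hT => le_iInf fun V' => le_iInf fun hV' => ?_
      by_cases h : ∀ z, jointYX T V' z ≠ 0 → jointXY P W z ≠ 0
      · rw [EcPObj_of_ac R K hT hV' h, EReal.coe_le_coe_iff]
        exact hmin _ ⟨jointYX_mem hT hV', h⟩
      · rw [EcPObj_eq_top R K h]
        exact le_top
  exact ⟨hE, margY Q, margY_mem hQ.1, V, hV, by rw [hobj, hE]⟩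

/-! ### Divergence inequalities and the comparison of the two exponents -/

/-- The squared Hellinger distance is bounded by the divergence. -/
theorem sum_sq_sqrt_sub_le {α : Type*} [Fintype α] {p q : α → ℝ} (hp : p ∈ stdSimplex ℝ α)
    (hq : ∀ a, 0 ≤ q a) (hq1 : ∑ a, q a ≤ 1) (h : ∀ a, p a ≠ 0 → q a ≠ 0) :
    ∑ a, (√(p a) - √(q a)) ^ 2 ≤ negEntropy p - expLog q p := by
  have key : ∀ a, (√(p a) - √(q a)) ^ 2 ≤
      p a * Real.log (p a) - p a * Real.log (q a) - p a + q a := by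
    intro a
    rcases (hp.1 a).eq_or_lt with h0 | h0
    · simp [← h0, Real.sq_sqrt (hq a)]
    · have hqa : 0 < q a := (hq a).lt_of_ne' (h a h0.ne')
      -- Taking `log s ≤ s - 1` at `s = √(q/p)`, rather than at `q/p`, is what leaves a full square.
      have hl := Real.log_le_sub_one_of_pos (div_pos (Real.sqrt_pos.2 hqa) (Real.sqrt_pos.2 h0))
      rw [Real.log_div (Real.sqrt_pos.2 hqa).ne' (Real.sqrt_pos.2 h0).ne', Real.log_sqrt hqa.le,
        Real.log_sqrt h0.le] at hl
      have hm := mul_le_mul_of_nonneg_left hl h0.le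
      have e : p a * (√(q a) / √(p a) - 1) = √(p a) * √(q a) - p a := by
        have hs := Real.mul_self_sqrt h0.le
        have := (Real.sqrt_pos.2 h0).ne'
        generalize √(p a) = s at hs this ⊢
        rw [← hs]
        field_simp
      rw [e] at hm
      rw [sub_sq, Real.sq_sqrt h0.le, Real.sq_sqrt hqa.le]
      linarith
  calc ∑ a, (√(p a) - √(q a)) ^ 2
      ≤ ∑ a, (p a * Real.log (p a) - p a * Real.log (q a) - p a + q a) :=
        Finset.sum_le_sum fun a _ => key a
    _ = negEntropy p - expLog q p - ∑ a, p a + ∑ a, q a := by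
        simp only [Finset.sum_add_distrib, Finset.sum_sub_distrib]
        rfl
    _ ≤ negEntropy p - expLog q p := by rw [hp.2]; linarith

theorem expLog_le_negEntropy {α : Type*} [Fintype α] {p q : α → ℝ} (hp : p ∈ stdSimplex ℝ α)
    (hq : q ∈ stdSimplex ℝ α) (h : ∀ a, p a ≠ 0 → q a ≠ 0) : expLog q p ≤ negEntropy p := by
  have := sum_sq_sqrt_sub_le hp hq.1 hq.2.le h
  have h0 : 0 ≤ ∑ a, (√(p a) - √(q a)) ^ 2 := Finset.sum_nonneg fun a _ => sq_nonneg _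
  linarith

theorem expLog_fst (P : X → ℝ) (Q : X × Y → ℝ) :
    expLog (fun z => P z.1) Q = expLog P (margX Q) := by
  unfold expLog
  rw [Fintype.sum_prod_type]
  exact Finset.sum_congr rfl fun x _ =>
    (Finset.sum_mul Finset.univ (fun y => Q (x, y)) (Real.log (P x))).symm

/-- With `d = D(Q_X ‖ P) ≥ 0`, the claim reduces to `|t|⁺ ≤ d + |t - d|⁺`. -/
theorem jointObj_le_jointObjP {W : X → Y → ℝ} {P : X → ℝ} (hP : P ∈ stdSimplex ℝ X) (R K : ℝ)
    {Q : X × Y → ℝ} (hQ : Q ∈ dominatedBy (jointXY P W)) :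
    jointObj W R K Q ≤ jointObjP W P R K Q := by
  have hd : expLog P (margX Q) ≤ negEntropy (margX Q) := by
    refine expLog_le_negEntropy (margX_mem hQ.1) hP fun x hx => ?_
    obtain ⟨y, -, hy⟩ := Finset.exists_ne_zero_of_sum_ne_zero hx
    exact left_ne_zero_of_mul (hQ.2 _ hy)
  rw [← expLog_fst (Y := Y)] at hd
  unfold jointObj jointObjP
  generalize max 0 (-expLog (fun z => W z.1 z.2) Q - K) = b
  rcases max_cases 0 (R - (negEntropy Q - negEntropy (margX Q) - negEntropy (margY Q)) - b)
    with ⟨h, -⟩ | ⟨h, -⟩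
  · rw [h]
    have := le_max_left 0 (R - (negEntropy Q - negEntropy (margY Q) -
      expLog (fun z => P z.1) Q) - b)
    linarith
  · rw [h]
    have := le_max_right 0 (R - (negEntropy Q - negEntropy (margY Q) -
      expLog (fun z => P z.1) Q) - b)
    linarith

theorem jointObjP_margX (W : X → Y → ℝ) (R K : ℝ) (Q : X × Y → ℝ) :
    jointObjP W (margX Q) R K Q = jointObj W R K Q := by
  unfold jointObj jointObjP
  rw [expLog_margX]
  ring_nf

/-- The minimizing `P` is the first marginal of a joint law that is optimal for `Ec`. -/
theorem isLeast_EcP [Nonempty X] {W : X → Y → ℝ} (hW : IsKernel W) (R K : ℝ) :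
    IsLeast ((fun P => EcP W P R K) '' stdSimplex ℝ X) (Ec W R K) := by
  obtain ⟨Q, hQ, hmin⟩ := exists_jointObj_min hW R K
  have hE := (Ec_eq_of_isMin hW R K hQ hmin).1
  have lower : ∀ P ∈ stdSimplex ℝ X, Ec W R K ≤ EcP W P R K := by
    intro P hP
    obtain ⟨Q', hQ', hmin'⟩ := exists_jointObjP_min hW hP R K
    rw [hE, (EcP_eq_of_isMin hP R K hQ' hmin').1, EReal.coe_le_coe_iff]
    exact (hmin _ (dominatedBy_jointXY_subset W P hQ')).trans (jointObj_le_jointObjP hP R K hQ')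
  refine ⟨⟨margX Q, margX_mem hQ.1, le_antisymm ?_ (lower _ (margX_mem hQ.1))⟩, ?_⟩
  · have hQP : Q ∈ dominatedBy (jointXY (margX Q) W) :=
      ⟨hQ.1, fun z hz => mul_ne_zero (margX_pos hQ.1.1 hz).ne' (hQ.2 z hz)⟩
    obtain ⟨Q', hQ', hmin'⟩ := exists_jointObjP_min hW (margX_mem hQ.1) R K
    change EcP W (margX Q) R K ≤ _
    rw [hE, (EcP_eq_of_isMin (margX_mem hQ.1) R K hQ' hmin').1, EReal.coe_le_coe_iff,
      ← jointObjP_margX]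
    exact hmin' _ hQP
  · rintro _ ⟨P, hP, rfl⟩
    exact lower P hP

/-! ### Sums over product spaces -/

theorem sum_pi_prod {ι κ : Type*} [Fintype ι] [DecidableEq ι] [Fintype κ] (g : ι → κ → ℝ) :
    ∑ f : ι → κ, ∏ i, g i (f i) = ∏ i, ∑ k, g i k :=
  (Fintype.prod_sum g).symm

theorem sum_pi_prod_eq_one {ι κ : Type*} [Fintype ι] [DecidableEq ι] [Fintype κ]
    {p : ι → κ → ℝ} (hp : ∀ i, ∑ k, p i k = 1) : ∑ f : ι → κ, ∏ i, p i (f i) = 1 := by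
  rw [sum_pi_prod]
  exact Finset.prod_eq_one fun i _ => hp i

theorem sum_pi_prod_mul_apply {ι κ : Type*} [Fintype ι] [DecidableEq ι] [Fintype κ]
    {p : ι → κ → ℝ} (hp : ∀ i, ∑ k, p i k = 1) (i₀ : ι) (g : κ → ℝ) :
    ∑ f : ι → κ, (∏ i, p i (f i)) * g (f i₀) = ∑ k, p i₀ k * g k := by
  have h : ∀ f : ι → κ, (∏ i, p i (f i)) * g (f i₀) =
      ∏ i, p i (f i) * (if i = i₀ then g (f i) else 1) := fun f => by
    rw [Finset.prod_mul_distrib, Fintype.prod_ite_eq']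
  simp only [h]
  rw [sum_pi_prod fun i k => p i k * (if i = i₀ then g k else 1),
    Fintype.prod_eq_single i₀ fun i hi => by simp [hi, hp]]
  simp

/-- Independence of two distinct coordinates: both functions are spread over all coordinates as
factors equal to `1` elsewhere. -/
theorem sum_pi_prod_mul_apply_mul_apply {ι κ : Type*} [Fintype ι] [DecidableEq ι] [Fintype κ]
    {p : ι → κ → ℝ} (hp : ∀ i, ∑ k, p i k = 1) {i₀ i₁ : ι} (hi : i₁ ≠ i₀) (g h : κ → ℝ) :
    ∑ f : ι → κ, (∏ i, p i (f i)) * (g (f i₀) * h (f i₁)) =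
      (∑ k, p i₀ k * g k) * ∑ k, p i₁ k * h k := by
  have e : ∀ f : ι → κ, (∏ i, p i (f i)) * (g (f i₀) * h (f i₁)) =
      ∏ i, p i (f i) * ((if i = i₀ then g (f i) else 1) * (if i = i₁ then h (f i) else 1)) := by
    intro f
    rw [Finset.prod_mul_distrib, Finset.prod_mul_distrib, Fintype.prod_ite_eq',
      Fintype.prod_ite_eq']
  simp only [e]
  rw [sum_pi_prod fun i k => p i k * ((if i = i₀ then g k else 1) * (if i = i₁ then h k else 1))]
  have e2 : ∀ i, ∑ k, p i k * ((if i = i₀ then g k else 1) * (if i = i₁ then h k else 1)) =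
      (if i = i₀ then ∑ k, p i k * g k else 1) * (if i = i₁ then ∑ k, p i k * h k else 1) := by
    intro i
    by_cases h0 : i = i₀
    · have h1 : i ≠ i₁ := fun h1 => hi (h1.symm.trans h0)
      simp [h0, hi.symm]
    · by_cases h1 : i = i₁
      · simp [h1, hi]
      · simp [h0, h1, hp]
  simp only [e2]
  rw [Finset.prod_mul_distrib, Fintype.prod_ite_eq', Fintype.prod_ite_eq']

/-- Change of measure for product weights on a set of words. -/
theorem sum_prod_le_of_le_mul_prod {n : ℕ} {α : Type*} [Fintype α] (S : Finset (Fin n → α))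
    (f g : Fin n → α → ℝ) (hg : ∀ i a, 0 ≤ g i a) (hg1 : ∀ i, ∑ a, g i a ≤ 1) {κ : ℝ}
    (hκ : 0 ≤ κ) (h : ∀ w ∈ S, ∏ i, f i (w i) ≤ κ * ∏ i, g i (w i)) :
    ∑ w ∈ S, ∏ i, f i (w i) ≤ κ := by
  calc ∑ w ∈ S, ∏ i, f i (w i) ≤ ∑ w ∈ S, κ * ∏ i, g i (w i) := Finset.sum_le_sum h
    _ ≤ ∑ w : Fin n → α, κ * ∏ i, g i (w i) :=
        Finset.sum_le_univ_sum_of_nonneg fun w =>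
          mul_nonneg hκ (Finset.prod_nonneg fun i _ => hg i _)
    _ = κ * ∏ i, ∑ a, g i a := by rw [← Finset.mul_sum, sum_pi_prod]
    _ ≤ κ * 1 := mul_le_mul_of_nonneg_left
        (Finset.prod_le_one (fun i _ => Finset.sum_nonneg fun a _ => hg i a) fun i _ => hg1 i) hκ
    _ = κ := mul_one κ

/-! ### Joint types -/

/-- Grouping positions by letter pair shows that memoryless probabilities depend on the words only
through their joint type. -/
theorem prod_eq_prod_pow_jointCount {n : ℕ} (f : X × Y → ℝ) (x : Fin n → X) (y : Fin n → Y) :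
    ∏ i, f (x i, y i) = ∏ z, f z ^ jointCount x y z := by
  classical
  rw [← Finset.prod_fiberwise Finset.univ (fun i => (x i, y i))]
  refine Finset.prod_congr rfl fun z _ => ?_
  rw [Finset.prod_congr rfl fun i hi => by rw [(Finset.mem_filter.1 hi).2], Finset.prod_const]
  unfold jointCount
  congr

theorem sum_jointCount {n : ℕ} (x : Fin n → X) (y : Fin n → Y) :
    ∑ z, jointCount x y z = n := by
  classical
  have := Finset.card_eq_sum_card_fiberwise (s := (Finset.univ : Finset (Fin n)))
    (t := Finset.univ) (f := fun i => (x i, y i)) (fun _ _ => Finset.mem_coe.2 (Finset.mem_univ _))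
  rw [Finset.card_univ, Fintype.card_fin] at this
  refine Eq.trans ?_ this.symm
  unfold jointCount
  refine Finset.sum_congr rfl fun z _ => ?_
  congr

/-- The joint type `τ / n`. -/
def typeDist (n : ℕ) (τ : X × Y → ℕ) : X × Y → ℝ := fun z => (τ z : ℝ) / n

theorem typeDist_mem {n : ℕ} (hn : n ≠ 0) {τ : X × Y → ℕ} (hτ : ∑ z, τ z = n) :
    typeDist n τ ∈ stdSimplex ℝ (X × Y) := by
  refine ⟨fun z => by unfold typeDist; positivity, ?_⟩
  unfold typeDist
  rw [← Finset.sum_div, ← Nat.cast_sum, hτ, div_self (Nat.cast_ne_zero.2 hn)]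

theorem typeDist_ne_zero {n : ℕ} (hn : n ≠ 0) {τ : X × Y → ℕ} {z : X × Y} :
    typeDist n τ z ≠ 0 ↔ τ z ≠ 0 := by
  simp [typeDist, hn]

theorem prod_eq_exp_expLog {n : ℕ} (hn : n ≠ 0) {τ : X × Y → ℕ} {x : Fin n → X} {y : Fin n → Y}
    (hxy : jointCount x y = τ) {f : X × Y → ℝ} (hf : ∀ z, τ z ≠ 0 → 0 < f z) :
    ∏ i, f (x i, y i) = Real.exp (n * expLog f (typeDist n τ)) := by
  rw [prod_eq_prod_pow_jointCount, hxy, expLog, Finset.mul_sum, Real.exp_sum]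
  refine Finset.prod_congr rfl fun z _ => ?_
  by_cases hz : τ z = 0
  · simp [hz, typeDist]
  · have hn' : (n : ℝ) ≠ 0 := Nat.cast_ne_zero.2 hn
    rw [typeDist, ← mul_assoc, mul_div_cancel₀ _ hn', mul_comm, Real.exp_mul,
      Real.exp_log (hf z hz), Real.rpow_natCast]

theorem typeDist_pos {n : ℕ} (hn : n ≠ 0) {τ : X × Y → ℕ} {z : X × Y} (hz : τ z ≠ 0) :
    0 < typeDist n τ z := by
  have : 0 < τ z := Nat.pos_of_ne_zero hz
  have : 0 < n := Nat.pos_of_ne_zero hn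
  unfold typeDist
  positivity

theorem expLog_div {α : Type*} [Fintype α] {Q f g : α → ℝ} (hf : ∀ z, Q z ≠ 0 → f z ≠ 0)
    (hg : ∀ z, Q z ≠ 0 → g z ≠ 0) :
    expLog (fun z => f z / g z) Q = expLog f Q - expLog g Q := by
  unfold expLog
  rw [← Finset.sum_sub_distrib]
  refine Finset.sum_congr rfl fun z _ => ?_
  by_cases hz : Q z = 0
  · simp [hz]
  · rw [Real.log_div (hf z hz) (hg z hz), mul_sub]

theorem expLog_mul {α : Type*} [Fintype α] {Q f g : α → ℝ} (hf : ∀ z, Q z ≠ 0 → f z ≠ 0)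
    (hg : ∀ z, Q z ≠ 0 → g z ≠ 0) :
    expLog (fun z => f z * g z) Q = expLog f Q + expLog g Q := by
  unfold expLog
  rw [← Finset.sum_add_distrib]
  refine Finset.sum_congr rfl fun z _ => ?_
  by_cases hz : Q z = 0
  · simp [hz]
  · rw [Real.log_mul (hf z hz) (hg z hz), mul_add]

open Classical in
/-- The number of words `y` of joint type `τ / n` with a given `x` is at most `exp (n H(Y|X))`. -/
theorem card_condType_le {n : ℕ} (hn : n ≠ 0) {τ : X × Y → ℕ} (x : Fin n → X) :
    ((Finset.univ.filter fun y : Fin n → Y => jointCount x y = τ).card : ℝ) ≤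
      Real.exp (n * (negEntropy (margX (typeDist n τ)) - negEntropy (typeDist n τ))) := by
  set Q := typeDist n τ with hQ
  have hQ0 : ∀ z, 0 ≤ Q z := fun z => by rw [hQ, typeDist]; positivity
  have hm : ∀ z, Q z ≠ 0 → margX Q z.1 ≠ 0 := fun z hz => (margX_pos hQ0 hz).ne'
  have hm0 : ∀ a, 0 ≤ margX Q a := fun a => Finset.sum_nonneg fun _ _ => hQ0 _
  have key := sum_prod_le_of_le_mul_prod
    (Finset.univ.filter fun y : Fin n → Y => jointCount x y = τ)
    (fun _ _ => 1) (fun i b => Q (x i, b) / margX Q (x i))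
    (fun i b => div_nonneg (hQ0 _) (hm0 _))
    -- Where the marginal vanishes the quotients are all `0`, so the weights are in general only
    -- sub-probabilities.
    (fun i => by rw [← Finset.sum_div]; exact div_self_le_one _)
    (Real.exp_pos (n * (negEntropy (margX Q) - negEntropy Q))).le
    (fun y hy => by
      have hy' := (Finset.mem_filter.1 hy).2
      have e := prod_eq_exp_expLog hn hy' (f := fun z => Q z / margX Q z.1) (fun z hz => by
        have h0 := typeDist_pos hn hz
        exact div_pos h0 (margX_pos hQ0 h0.ne'))
      rw [expLog_div (fun z hz => hz) hm, expLog_margX] at e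
      simp only [Finset.prod_const_one]
      rw [e, ← Real.exp_add]
      refine (Real.one_le_exp_iff.2 (le_of_eq ?_))
      change 0 = n * (negEntropy (margX Q) - negEntropy Q) +
        n * (negEntropy Q - negEntropy (margX Q))
      ring)
  simpa using key

open Classical in
/-- The number of words of type `τ_Y / n` is at most `exp (n H(Y))`. -/
theorem card_margType_le {n : ℕ} (hn : n ≠ 0) {τ : X × Y → ℕ} (hτ : ∑ z, τ z = n) :
    ((Finset.univ.filter fun y : Fin n → Y => ∃ x : Fin n → X, jointCount x y = τ).card : ℝ) ≤
      Real.exp (n * (-negEntropy (margY (typeDist n τ)))) := by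
  have hQ1 := typeDist_mem hn hτ
  set Q := typeDist n τ with hQ
  have key := sum_prod_le_of_le_mul_prod
    (Finset.univ.filter fun y : Fin n → Y => ∃ x : Fin n → X, jointCount x y = τ)
    (fun _ _ => 1) (fun _ b => margY Q b)
    (fun _ b => (margY_mem hQ1).1 b) (fun _ => (margY_mem hQ1).2.le)
    (Real.exp_pos (n * (-negEntropy (margY Q)))).le
    (fun y hy => by
      obtain ⟨x, hx⟩ := (Finset.mem_filter.1 hy).2
      have e := prod_eq_exp_expLog hn hx (f := fun z => margY Q z.2) (fun z hz =>
        margY_pos hQ1.1 (typeDist_pos hn hz).ne')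
      rw [← hQ, expLog_margY] at e
      simp only [Finset.prod_const_one]
      rw [e, ← Real.exp_add]
      exact (Real.one_le_exp_iff.2 (le_of_eq (by ring))))
  simpa using key

open Classical in
/-- The probability that an i.i.d. word `x` has the joint type `τ / n` with a given `y`, estimated
by means of an auxiliary conditional distribution. -/
theorem sum_condType_prod_le {n : ℕ} (hn : n ≠ 0) {τ : X × Y → ℕ} (y : Fin n → Y)
    {P : X → ℝ} {V : X × Y → ℝ} (hP : ∀ z, τ z ≠ 0 → 0 < P z.1) (hV : ∀ z, τ z ≠ 0 → 0 < V z)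
    (hV0 : ∀ z, 0 ≤ V z) (hV1 : ∀ b, ∑ a, V (a, b) ≤ 1) :
    ∑ x : Fin n → X with jointCount x y = τ, ∏ i, P (x i) ≤
      Real.exp (n * (expLog (fun z => P z.1) (typeDist n τ) - expLog V (typeDist n τ))) := by
  refine sum_prod_le_of_le_mul_prod _ (fun _ => P) (fun i a => V (a, y i)) (fun i a => hV0 _)
    (fun i => hV1 _) (Real.exp_pos _).le fun x hx => le_of_eq ?_
  have hx' := (Finset.mem_filter.1 hx).2
  have e1 := prod_eq_exp_expLog hn hx' (f := fun z => P z.1) hP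
  rw [e1, prod_eq_exp_expLog hn hx' hV, ← Real.exp_add]
  congr 1
  ring

open Classical in
/-- The probability that i.i.d. pairs with law `q` have the joint type `τ / n`. -/
def typeProb (n : ℕ) (q : X × Y → ℝ) (τ : X × Y → ℕ) : ℝ :=
  ∑ x : Fin n → X, ∑ y : Fin n → Y, if jointCount x y = τ then ∏ i, q (x i, y i) else 0

theorem sum_sum_prod_eq_one {n : ℕ} {q : X × Y → ℝ} (hq : q ∈ stdSimplex ℝ (X × Y)) :
    ∑ x : Fin n → X, ∑ y : Fin n → Y, ∏ i, q (x i, y i) = 1 := by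
  rw [← sum_pi_prod_eq_one (ι := Fin n) (p := fun _ => q) fun _ => hq.2,
    ← Fintype.sum_prod_type' (f := fun (x : Fin n → X) (y : Fin n → Y) => ∏ i, q (x i, y i))]
  exact ((Equiv.arrowProdEquivProdArrow (Fin n) (fun _ => X) fun _ => Y).sum_comp
    fun w => ∏ i, q (w.1 i, w.2 i)).symm

/-- On words of type `τ / n` both product weights are constant, and so is their ratio. -/
theorem typeProb_eq_mul {n : ℕ} (hn : n ≠ 0) {τ : X × Y → ℕ} {q r : X × Y → ℝ}
    (hq : ∀ z, τ z ≠ 0 → 0 < q z) (hr : ∀ z, τ z ≠ 0 → 0 < r z) :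
    typeProb n q τ =
      Real.exp (n * (expLog q (typeDist n τ) - expLog r (typeDist n τ))) * typeProb n r τ := by
  unfold typeProb
  simp only [Finset.mul_sum]
  refine Finset.sum_congr rfl fun x _ => Finset.sum_congr rfl fun y _ => ?_
  split_ifs with h
  · rw [prod_eq_exp_expLog hn h hq, prod_eq_exp_expLog hn h hr, ← Real.exp_add]
    congr 1
    ring
  · simp

theorem typeProb_le_one {n : ℕ} {τ : X × Y → ℕ} {q : X × Y → ℝ}
    (hq : q ∈ stdSimplex ℝ (X × Y)) : typeProb n q τ ≤ 1 := by
  rw [← sum_sum_prod_eq_one (n := n) hq]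
  refine Finset.sum_le_sum fun x _ => Finset.sum_le_sum fun y _ => ?_
  split_ifs
  · exact le_rfl
  · exact Finset.prod_nonneg fun i _ => hq.1 _

/-- The change of measure to the type itself leaves a probability, at most `1`; the exponent is the
divergence of the type from `q`. -/
theorem typeProb_le_exp {n : ℕ} (hn : n ≠ 0) {τ : X × Y → ℕ} (hτ : ∑ z, τ z = n)
    {q : X × Y → ℝ} (hq : ∀ z, τ z ≠ 0 → 0 < q z) :
    typeProb n q τ ≤
      Real.exp (n * (expLog q (typeDist n τ) - negEntropy (typeDist n τ))) := by
  rw [typeProb_eq_mul hn hq fun z hz => typeDist_pos hn hz]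
  exact mul_le_of_le_one_right (Real.exp_pos _).le (typeProb_le_one (typeDist_mem hn hτ))

open Classical in
/-- A finite set of counts that contains `n` times each joint type with denominator `n`. -/
def countSet (X Y : Type*) [Fintype X] [Fintype Y] (n : ℕ) : Finset (X × Y → ℕ) :=
  Fintype.piFinset fun _ => Finset.range (n + 1)

theorem jointCount_mem_countSet {n : ℕ} (x : Fin n → X) (y : Fin n → Y) :
    jointCount x y ∈ countSet X Y n := by
  classical
  refine Fintype.mem_piFinset.2 fun z => Finset.mem_range_succ_iff.2 ?_
  conv_rhs => rw [← sum_jointCount x y]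
  exact Finset.single_le_sum (f := fun z => jointCount x y z) (fun _ _ => Nat.zero_le _)
    (Finset.mem_univ z)

theorem card_countSet (n : ℕ) :
    (countSet X Y n).card = (n + 1) ^ (Fintype.card X * Fintype.card Y) := by
  classical
  simp [countSet, Fintype.card_piFinset]

/-- Pigeonhole over at most `(n + 1) ^ (|X| |Y|)` types. A type of positive probability
automatically lives on the support of `q`. -/
theorem exists_typeProb_ge (n : ℕ) {q : X × Y → ℝ} (hq : q ∈ stdSimplex ℝ (X × Y)) :
    ∃ τ : X × Y → ℕ, ∑ z, τ z = n ∧ (∀ z, τ z ≠ 0 → 0 < q z) ∧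
      1 ≤ ((n : ℝ) + 1) ^ (Fintype.card X * Fintype.card Y) * typeProb n q τ := by
  classical
  have hsum : ∑ τ ∈ countSet X Y n, typeProb n q τ = 1 := by
    unfold typeProb
    rw [← sum_sum_prod_eq_one (n := n) hq, Finset.sum_comm]
    refine Finset.sum_congr rfl fun x _ => ?_
    rw [Finset.sum_comm]
    refine Finset.sum_congr rfl fun y _ => ?_
    rw [Finset.sum_ite_eq, if_pos (jointCount_mem_countSet x y)]
  have hne : (countSet X Y n).Nonempty := by
    by_contra h
    rw [Finset.not_nonempty_iff_eq_empty] at h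
    simp [h] at hsum
  obtain ⟨τ, hτ, hmax⟩ := Finset.exists_max_image (countSet X Y n) (typeProb n q) hne
  have hge : 1 ≤ ((n : ℝ) + 1) ^ (Fintype.card X * Fintype.card Y) * typeProb n q τ := by
    have := Finset.sum_le_card_nsmul _ _ _ hmax
    rw [hsum, card_countSet, nsmul_eq_mul] at this
    exact_mod_cast this
  have hpos : typeProb n q τ ≠ 0 := by
    intro h
    rw [h, mul_zero] at hge
    linarith
  obtain ⟨x, -, hx⟩ := Finset.exists_ne_zero_of_sum_ne_zero hpos
  obtain ⟨y, -, hy⟩ := Finset.exists_ne_zero_of_sum_ne_zero hx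
  rw [Ne, ite_eq_right_iff, Classical.not_imp] at hy
  obtain ⟨hxy, hy⟩ := hy
  refine ⟨τ, by rw [← hxy, sum_jointCount], fun z hz => (hq.1 z).lt_of_ne' fun h0 => hy ?_, hge⟩
  rw [prod_eq_prod_pow_jointCount, hxy]
  exact Finset.prod_eq_zero (Finset.mem_univ z) (by rw [h0, zero_pow hz])

/-! ### The channel ensemble: expectations -/

/-- The memoryless transition probability of words. -/
def wordProb {n : ℕ} (W : X → Y → ℝ) (x : Fin n → X) (y : Fin n → Y) : ℝ := ∏ i, W (x i) (y i)

/-- The probability of a cloud of independent outputs for the input word `x`. -/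
def cloudProb {n N : ℕ} (W : X → Y → ℝ) (x : Fin n → X) (c : Fin N → Fin n → Y) : ℝ :=
  ∏ j, wordProb W x (c j)

open Classical in
/-- The number of replicas of `y` in a cloud. -/
def replicas {n N : ℕ} (c : Fin N → Fin n → Y) (y : Fin n → Y) : ℕ :=
  (Finset.univ.filter fun j => c j = y).card

theorem wordProb_nonneg {n : ℕ} {W : X → Y → ℝ} (hW : IsKernel W) (x : Fin n → X)
    (y : Fin n → Y) : 0 ≤ wordProb W x y :=
  Finset.prod_nonneg fun _ _ => (hW _).1 _

theorem sum_wordProb {n : ℕ} {W : X → Y → ℝ} (hW : IsKernel W) (x : Fin n → X) :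
    ∑ y, wordProb W x y = 1 :=
  sum_pi_prod_eq_one (p := fun i => W (x i)) fun i => (hW (x i)).2

theorem cloudProb_nonneg {n N : ℕ} {W : X → Y → ℝ} (hW : IsKernel W) (x : Fin n → X)
    (c : Fin N → Fin n → Y) : 0 ≤ cloudProb W x c :=
  Finset.prod_nonneg fun _ _ => wordProb_nonneg hW _ _

theorem sum_cloudProb {n : ℕ} (N : ℕ) {W : X → Y → ℝ} (hW : IsKernel W) (x : Fin n → X) :
    ∑ c : Fin N → Fin n → Y, cloudProb W x c = 1 :=
  sum_pi_prod_eq_one (p := fun _ => wordProb W x) fun _ => sum_wordProb hW x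

theorem instanceProb_eq {n M N : ℕ} (W : X → Y → ℝ) (C : Codebook X n M) (c : Clouds Y n M N) :
    instanceProb W C c = ∏ m, cloudProb W (C m) (c m) := rfl

theorem instanceProb_nonneg {n M N : ℕ} {W : X → Y → ℝ} (hW : IsKernel W) (C : Codebook X n M)
    (c : Clouds Y n M N) : 0 ≤ instanceProb W C c :=
  Finset.prod_nonneg fun _ _ => cloudProb_nonneg hW _ _

theorem sum_instanceProb {n M : ℕ} (N : ℕ) {W : X → Y → ℝ} (hW : IsKernel W)
    (C : Codebook X n M) : ∑ c : Clouds Y n M N, instanceProb W C c = 1 :=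
  sum_pi_prod_eq_one (p := fun m => cloudProb W (C m)) fun m => sum_cloudProb N hW (C m)

theorem sum_instanceProb_mul {n M N : ℕ} {W : X → Y → ℝ} (hW : IsKernel W) (C : Codebook X n M)
    (m : Fin M) (g : (Fin N → Fin n → Y) → ℝ) :
    ∑ c : Clouds Y n M N, instanceProb W C c * g (c m) = ∑ c, cloudProb W (C m) c * g c :=
  sum_pi_prod_mul_apply (p := fun m => cloudProb W (C m)) (fun m => sum_cloudProb N hW (C m)) m g

theorem sum_cloud_eq {n N : ℕ} (c : Fin N → Fin n → Y) (f : (Fin n → Y) → ℝ) :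
    ∑ j, f (c j) = ∑ y, (replicas c y : ℝ) * f y := by
  classical
  rw [← Finset.sum_fiberwise Finset.univ c]
  refine Finset.sum_congr rfl fun y _ => ?_
  rw [Finset.sum_congr rfl fun j hj => by rw [(Finset.mem_filter.1 hj).2], Finset.sum_const,
    nsmul_eq_mul]
  unfold replicas
  congr

theorem replicas_eq_sum {n N : ℕ} [DecidableEq (Fin n → Y)] (c : Fin N → Fin n → Y)
    (y : Fin n → Y) : (replicas c y : ℝ) = ∑ j, if c j = y then (1 : ℝ) else 0 := by
  rw [Finset.sum_boole]
  unfold replicas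
  congr

theorem sum_cloudProb_mul_replicas {n N : ℕ} {W : X → Y → ℝ} (hW : IsKernel W) (x : Fin n → X)
    (y : Fin n → Y) :
    ∑ c : Fin N → Fin n → Y, cloudProb W x c * replicas c y = N * wordProb W x y := by
  classical
  simp only [replicas_eq_sum, Finset.mul_sum]
  rw [Finset.sum_comm]
  have key : ∀ j : Fin N, ∑ c : Fin N → Fin n → Y, cloudProb W x c *
      (if c j = y then (1 : ℝ) else 0) = wordProb W x y := fun j =>
    (sum_pi_prod_mul_apply (p := fun _ => wordProb W x) (fun _ => sum_wordProb hW x) j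
      fun y' => if y' = y then 1 else 0).trans (by simp)
  simp only [key]
  simp

/-- The replica count is binomial with success probability `p = wordProb W x y`, so the moment is
`(1 + (e - 1) p) ^ N`, and `e - 1 ≤ 2`. -/
theorem sum_cloudProb_mul_exp_replicas_le {n N : ℕ} {W : X → Y → ℝ} (hW : IsKernel W)
    (x : Fin n → X) (y : Fin n → Y) :
    ∑ c : Fin N → Fin n → Y, cloudProb W x c * Real.exp (replicas c y) ≤
      Real.exp (2 * (N * wordProb W x y)) := by
  classical
  have e : ∀ c : Fin N → Fin n → Y, cloudProb W x c * Real.exp (replicas c y) =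
      ∏ j, wordProb W x (c j) * (if c j = y then Real.exp 1 else 1) := by
    intro c
    rw [replicas_eq_sum, Real.exp_sum, cloudProb, Finset.prod_mul_distrib]
    congr 1
    refine Finset.prod_congr rfl fun j _ => ?_
    split_ifs <;> simp
  simp only [e]
  rw [sum_pi_prod fun (_ : Fin N) y' => wordProb W x y' * (if y' = y then Real.exp 1 else 1),
    Finset.prod_const, Finset.card_univ, Fintype.card_fin]
  have e2 : ∑ y', wordProb W x y' * (if y' = y then Real.exp 1 else 1) =
      wordProb W x y * (Real.exp 1 - 1) + 1 := by
    have : ∀ y', wordProb W x y' * (if y' = y then Real.exp 1 else 1) =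
        wordProb W x y' * (if y' = y then Real.exp 1 - 1 else 0) + wordProb W x y' := by
      intro y'
      split_ifs <;> ring
    simp only [this]
    rw [Finset.sum_add_distrib, sum_wordProb hW]
    simp
  have hp := wordProb_nonneg hW x y
  rw [e2, mul_left_comm, Real.exp_nat_mul]
  refine pow_le_pow_left₀ (by nlinarith [Real.add_one_le_exp (1 : ℝ)]) ?_ N
  calc wordProb W x y * (Real.exp 1 - 1) + 1 ≤ 2 * wordProb W x y + 1 := by
        nlinarith [Real.exp_one_lt_d9]
    _ ≤ _ := Real.add_one_le_exp _

/-- Cloud members are regrouped by their value `y`, which turns the choice of a member into the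
weight `replicas`. -/
theorem one_sub_errProb {n M N : ℕ} (hM : M ≠ 0) (hN : N ≠ 0) {W : X → Y → ℝ} (hW : IsKernel W)
    (φ : Decoder X Y n M N) (C : Codebook X n M) :
    1 - errProb W φ C = 1 / ((M : ℝ) * N) * ∑ c : Clouds Y n M N, instanceProb W C c *
      ∑ y, ∑ m, (replicas (c m) y : ℝ) * φ C c y m := by
  have hM' : (M : ℝ) ≠ 0 := Nat.cast_ne_zero.2 hM
  have hN' : (N : ℝ) ≠ 0 := Nat.cast_ne_zero.2 hN
  have e : ∀ c : Clouds Y n M N,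
      (1 / (M : ℝ)) * ∑ m, (1 / (N : ℝ)) * ∑ j, (1 - φ C c (c m j) m) =
        1 - 1 / ((M : ℝ) * N) * ∑ y, ∑ m, (replicas (c m) y : ℝ) * φ C c y m := by
    intro c
    rw [Finset.sum_comm (γ := Fin n → Y)]
    simp only [← sum_cloud_eq (c _) fun y => φ C c y _, Finset.sum_sub_distrib,
      Finset.sum_const, Finset.card_univ, Fintype.card_fin, nsmul_eq_mul, mul_one,
      ← Finset.mul_sum]
    field_simp
  have e2 : errProb W φ C = ∑ c : Clouds Y n M N, instanceProb W C c *
      (1 - 1 / ((M : ℝ) * N) * ∑ y, ∑ m, (replicas (c m) y : ℝ) * φ C c y m) :=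
    Finset.sum_congr rfl fun c _ => by rw [e c]
  rw [e2]
  simp only [mul_sub, mul_one, Finset.sum_sub_distrib, sum_instanceProb N hW, sub_sub_cancel,
    Finset.mul_sum]
  refine Finset.sum_congr rfl fun c _ => Finset.sum_congr rfl fun y _ =>
    Finset.sum_congr rfl fun m _ => ?_
  ring

theorem one_le_exp_nat_mul (n : ℕ) {r : ℝ} (hr : 0 < r) : 1 ≤ Real.exp (n * r) :=
  Real.one_le_exp (by positivity)

theorem expSize_ne_zero (n : ℕ) {r : ℝ} (hr : 0 < r) : expSize n r ≠ 0 :=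
  (Nat.floor_pos.2 (one_le_exp_nat_mul n hr)).ne'

theorem expSize_le (n : ℕ) (r : ℝ) : (expSize n r : ℝ) ≤ Real.exp (n * r) :=
  Nat.floor_le (Real.exp_pos _).le

/-- Rounding down a number that is at least `1` loses at most a factor of two. -/
theorem one_div_expSize_le (n : ℕ) {r : ℝ} (hr : 0 < r) :
    1 / (expSize n r : ℝ) ≤ 2 * Real.exp (-(n * r)) := by
  have h1 : (1 : ℝ) ≤ expSize n r :=
    Nat.one_le_cast.2 (Nat.one_le_iff_ne_zero.2 (expSize_ne_zero n hr))
  have h2 : Real.exp (n * r) < expSize n r + 1 := Nat.lt_floor_add_one _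
  rw [Real.exp_neg, div_le_iff₀ (by linarith), mul_assoc, ← div_eq_inv_mul,
    ← mul_div_assoc, le_div_iff₀ (Real.exp_pos _)]
  linarith

/-! ### Converse -/

open Classical in
/-- The contribution of the joint type `τ / n` to the number of correctly decoded replicas. -/
def typeContribution {n M N : ℕ} (W : X → Y → ℝ) (φ : Decoder X Y n M N) (C : Codebook X n M)
    (τ : X × Y → ℕ) (y : Fin n → Y) : ℝ :=
  ∑ c : Clouds Y n M N, instanceProb W C c *
    ∑ m, if jointCount (C m) y = τ then (replicas (c m) y : ℝ) * φ C c y m else 0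

theorem sum_typeContribution {n M N : ℕ} (W : X → Y → ℝ) (φ : Decoder X Y n M N)
    (C : Codebook X n M) :
    ∑ τ ∈ countSet X Y n, ∑ y, typeContribution W φ C τ y = ∑ c : Clouds Y n M N,
      instanceProb W C c * ∑ y, ∑ m, (replicas (c m) y : ℝ) * φ C c y m := by
  classical
  unfold typeContribution
  have e : ∀ (c : Clouds Y n M N) (y : Fin n → Y) (m : Fin M),
      (replicas (c m) y : ℝ) * φ C c y m = ∑ τ ∈ countSet X Y n,
        if jointCount (C m) y = τ then (replicas (c m) y : ℝ) * φ C c y m else 0 :=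
    fun c y m => by rw [Finset.sum_ite_eq, if_pos (jointCount_mem_countSet _ _)]
  refine Eq.trans ?_ (Finset.sum_congr rfl fun c _ => congrArg (_ * ·) (Finset.sum_congr rfl
    fun y _ => Finset.sum_congr rfl fun m _ => (e c y m).symm))
  rw [Finset.sum_congr rfl fun τ _ => Finset.sum_comm, Finset.sum_comm]
  refine Finset.sum_congr rfl fun c _ => ?_
  rw [Finset.mul_sum, Finset.sum_comm]
  refine Finset.sum_congr rfl fun y _ => ?_
  rw [← Finset.mul_sum, Finset.sum_comm]

open Classical in
-- Replacing every decoding weight by `1` leaves the mean replica count `N * wordProb`.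
theorem typeContribution_le_sum {n M N : ℕ} {W : X → Y → ℝ} (hW : IsKernel W)
    {φ : Decoder X Y n M N} {C : Codebook X n M} (hφ : ∀ c y m, φ C c y m ≤ 1)
    (τ : X × Y → ℕ) (y : Fin n → Y) :
    typeContribution W φ C τ y ≤
      ∑ m, if jointCount (C m) y = τ then N * wordProb W (C m) y else 0 := by
  calc typeContribution W φ C τ y
      ≤ ∑ c : Clouds Y n M N, instanceProb W C c *
          ∑ m, if jointCount (C m) y = τ then (replicas (c m) y : ℝ) else 0 := by
        refine Finset.sum_le_sum fun c _ => mul_le_mul_of_nonneg_left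
          (Finset.sum_le_sum fun m _ => ?_) (instanceProb_nonneg hW C c)
        split_ifs
        · exact mul_le_of_le_one_right (Nat.cast_nonneg _) (hφ c y m)
        · exact le_rfl
    _ = ∑ m, if jointCount (C m) y = τ then N * wordProb W (C m) y else 0 := by
        simp only [Finset.mul_sum]
        rw [Finset.sum_comm]
        refine Finset.sum_congr rfl fun m _ => ?_
        split_ifs
        · rw [← sum_cloudProb_mul_replicas hW]
          exact sum_instanceProb_mul hW C m fun c => (replicas c y : ℝ)
        · simp

open Classical in
-- A soft maximum: each replica count exceeds the threshold `a` by at most `exp (replicas - a)`. The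
-- threshold is paid only once because the decoding weights sum to at most one.
theorem typeContribution_le_add {n M N : ℕ} {W : X → Y → ℝ} (hW : IsKernel W)
    {φ : Decoder X Y n M N} {C : Codebook X n M} (hφ0 : ∀ c y m, 0 ≤ φ C c y m)
    (hφ1 : ∀ c y, ∑ m, φ C c y m ≤ 1) (τ : X × Y → ℕ) (y : Fin n → Y) {a : ℝ} (ha : 0 ≤ a) :
    typeContribution W φ C τ y ≤ a +
      ∑ m, if jointCount (C m) y = τ then Real.exp (2 * (N * wordProb W (C m) y) - a) else 0 := by
  have hφ : ∀ c y m, φ C c y m ≤ 1 := fun c y m =>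
    (Finset.single_le_sum (fun m _ => hφ0 c y m) (Finset.mem_univ m)).trans (hφ1 c y)
  calc typeContribution W φ C τ y
      ≤ ∑ c : Clouds Y n M N, instanceProb W C c *
          (a + ∑ m, if jointCount (C m) y = τ then Real.exp (replicas (c m) y - a) else 0) := by
        refine Finset.sum_le_sum fun c _ => mul_le_mul_of_nonneg_left ?_
          (instanceProb_nonneg hW C c)
        calc _ ≤ ∑ m, (a * φ C c y m +
              if jointCount (C m) y = τ then Real.exp (replicas (c m) y - a) else 0) := by
              refine Finset.sum_le_sum fun m _ => ?_
              have h0 := hφ0 c y m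
              have h1 := hφ c y m
              split_ifs
              · have h2 := Real.add_one_le_exp ((replicas (c m) y : ℝ) - a)
                have h3 := (Real.exp_pos ((replicas (c m) y : ℝ) - a)).le
                nlinarith [mul_le_of_le_one_right h3 h1]
              · have := mul_nonneg ha h0
                linarith
          _ ≤ _ := by
              rw [Finset.sum_add_distrib, ← Finset.mul_sum]
              gcongr
              exact mul_le_of_le_one_right ha (hφ1 c y)
    _ = a + ∑ m, if jointCount (C m) y = τ then
          ∑ c : Fin N → Fin n → Y, cloudProb W (C m) c * Real.exp (replicas c y - a) else 0 := by
        simp only [mul_add, Finset.sum_add_distrib, ← Finset.sum_mul, sum_instanceProb N hW,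
          one_mul, Finset.mul_sum]
        congr 1
        rw [Finset.sum_comm]
        refine Finset.sum_congr rfl fun m _ => ?_
        split_ifs
        · exact sum_instanceProb_mul hW C m fun c => Real.exp (replicas c y - a)
        · simp
    _ ≤ _ := by
        gcongr with m _
        split_ifs
        · simp only [Real.exp_sub, ← mul_div_assoc]
          rw [← Finset.sum_div]
          gcongr
          exact sum_cloudProb_mul_exp_replicas_le hW _ _
        · exact le_rfl

theorem typeContribution_eq_zero {n M N : ℕ} (W : X → Y → ℝ) (φ : Decoder X Y n M N)
    (C : Codebook X n M) {τ : X × Y → ℕ} {y : Fin n → Y}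
    (h : ¬ ∃ x : Fin n → X, jointCount x y = τ) : typeContribution W φ C τ y = 0 := by
  classical
  refine Finset.sum_eq_zero fun c _ => ?_
  rw [Finset.sum_eq_zero fun m _ => if_neg fun h' => h ⟨C m, h'⟩, mul_zero]

theorem wordProb_eq_exp {n : ℕ} (hn : n ≠ 0) {W : X → Y → ℝ} (hW : IsKernel W)
    {τ : X × Y → ℕ} {x : Fin n → X} {y : Fin n → Y} (hxy : jointCount x y = τ)
    (hτ : ∀ z, τ z ≠ 0 → W z.1 z.2 ≠ 0) :
    wordProb W x y = Real.exp (n * expLog (fun z => W z.1 z.2) (typeDist n τ)) :=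
  prod_eq_exp_expLog hn hxy (f := fun z => W z.1 z.2) fun z hz =>
    ((hW z.1).1 z.2).lt_of_ne' (hτ z hz)

theorem wordProb_eq_zero {n : ℕ} {W : X → Y → ℝ} {τ : X × Y → ℕ} {x : Fin n → X}
    {y : Fin n → Y} (hxy : jointCount x y = τ) (hτ : ¬ ∀ z, τ z ≠ 0 → W z.1 z.2 ≠ 0) :
    wordProb W x y = 0 := by
  push Not at hτ
  obtain ⟨z, hz, hW⟩ := hτ
  have := prod_eq_prod_pow_jointCount (fun z => W z.1 z.2) x y
  rw [hxy] at this
  exact this.trans (Finset.prod_eq_zero (Finset.mem_univ z) (by simp [hW, hz]))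

theorem sum_typeContribution_le_exp {n M N : ℕ} (hn : n ≠ 0) {W : X → Y → ℝ} (hW : IsKernel W)
    {φ : Decoder X Y n M N} {C : Codebook X n M} (hφ : ∀ c y m, φ C c y m ≤ 1)
    {τ : X × Y → ℕ} (hτ : ∀ z, τ z ≠ 0 → W z.1 z.2 ≠ 0) :
    ∑ y, typeContribution W φ C τ y ≤ M * N * Real.exp (n * -(negEntropy (typeDist n τ) -
      negEntropy (margX (typeDist n τ)) - expLog (fun z => W z.1 z.2) (typeDist n τ))) := by
  classical
  calc ∑ y, typeContribution W φ C τ y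
      ≤ ∑ y, ∑ m, if jointCount (C m) y = τ then N * wordProb W (C m) y else 0 := by
        refine Finset.sum_le_sum fun y _ => (typeContribution_le_sum hW hφ τ y).trans (le_of_eq ?_)
        refine Finset.sum_congr rfl fun m _ => ?_
        congr
    _ = ∑ m, ((Finset.univ.filter fun y : Fin n → Y => jointCount (C m) y = τ).card : ℝ) *
          (N * Real.exp (n * expLog (fun z => W z.1 z.2) (typeDist n τ))) := by
        rw [Finset.sum_comm]
        refine Finset.sum_congr rfl fun m _ => ?_
        rw [← Finset.sum_filter, ← nsmul_eq_mul, ← Finset.sum_const]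
        exact Finset.sum_congr rfl fun y hy => by
          rw [wordProb_eq_exp hn hW (Finset.mem_filter.1 hy).2 hτ]
    _ ≤ ∑ m : Fin M, Real.exp (n * (negEntropy (margX (typeDist n τ)) -
          negEntropy (typeDist n τ))) *
          (N * Real.exp (n * expLog (fun z => W z.1 z.2) (typeDist n τ))) := by
        refine Finset.sum_le_sum fun m _ => mul_le_mul_of_nonneg_right ?_ (by positivity)
        refine le_trans (le_of_eq ?_) (card_condType_le hn (C m))
        congr
    _ = _ := by
        rw [Finset.sum_const, Finset.card_univ, Fintype.card_fin, nsmul_eq_mul]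
        have e : ∀ a b c : ℝ, Real.exp (n * -(a - b - c)) =
            Real.exp (n * (b - a)) * Real.exp (n * c) := fun a b c => by
          rw [← Real.exp_add]
          congr 1
          ring
        rw [e]
        ring

theorem sum_typeContribution_le_add {n M N : ℕ} (hn : n ≠ 0) {W : X → Y → ℝ} (hW : IsKernel W)
    {φ : Decoder X Y n M N} {C : Codebook X n M} (hφ0 : ∀ c y m, 0 ≤ φ C c y m)
    (hφ1 : ∀ c y, ∑ m, φ C c y m ≤ 1) {τ : X × Y → ℕ} (hτn : ∑ z, τ z = n)
    (hτ : ∀ z, τ z ≠ 0 → W z.1 z.2 ≠ 0) {r : ℝ} (hr : 0 ≤ r) (hM : (M : ℝ) ≤ Real.exp r) :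
    ∑ y, typeContribution W φ C τ y ≤ Real.exp (n * -negEntropy (margY (typeDist n τ))) *
      (r + 1 + 2 * (N * Real.exp (n * expLog (fun z => W z.1 z.2) (typeDist n τ)))) := by
  classical
  set p := Real.exp (n * expLog (fun z => W z.1 z.2) (typeDist n τ)) with hp
  have hp0 : 0 ≤ 2 * (N * p) := by positivity
  have key : ∀ y, typeContribution W φ C τ y ≤ r + 1 + 2 * (N * p) := by
    intro y
    -- The threshold `a = r + 2Np` makes each exponential term equal to `exp (-r)`, so the at most
    -- `exp r` messages contribute at most `1` together.
    refine (typeContribution_le_add hW hφ0 hφ1 τ y (add_nonneg hr hp0)).trans ?_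
    have : (∑ m, if jointCount (C m) y = τ then
        Real.exp (2 * (N * wordProb W (C m) y) - (r + 2 * (N * p))) else 0) ≤
        ∑ _m : Fin M, Real.exp (-r) := by
      refine Finset.sum_le_sum fun m _ => ?_
      split_ifs with h
      · rw [wordProb_eq_exp hn hW h hτ, ← hp]
        exact le_of_eq (by congr 1; ring)
      · exact (Real.exp_pos _).le
    rw [Finset.sum_const, Finset.card_univ, Fintype.card_fin, nsmul_eq_mul] at this
    have h1 : (M : ℝ) * Real.exp (-r) ≤ 1 := by
      rw [Real.exp_neg, ← div_eq_mul_inv, div_le_one (Real.exp_pos r)]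
      exact hM
    refine le_trans (add_le_add_right ?_ _) (le_of_eq (?_ : r + 2 * (N * p) + 1 = _))
    · convert this.trans h1
    · ring
  calc ∑ y, typeContribution W φ C τ y
      = ∑ y : Fin n → Y with ∃ x : Fin n → X, jointCount x y = τ,
          typeContribution W φ C τ y := by
        rw [Finset.sum_filter]
        refine Finset.sum_congr rfl fun y _ => ?_
        split_ifs with h
        · rfl
        · exact typeContribution_eq_zero W φ C h
    _ ≤ ∑ y : Fin n → Y with ∃ x : Fin n → X, jointCount x y = τ, (r + 1 + 2 * (N * p)) :=
        Finset.sum_le_sum fun y _ => key y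
    _ ≤ _ := by
        rw [Finset.sum_const, nsmul_eq_mul]
        refine mul_le_mul_of_nonneg_right ?_ (by linarith)
        refine le_trans (le_of_eq ?_) (card_margType_le hn hτn)
        congr

/-- When the outer positive part is zero, the bound without competition suffices; otherwise the
maximum bound is used. -/
theorem typeContribution_div_le {n : ℕ} (hn : n ≠ 0) {R K : ℝ} (hR : 0 < R) (hK : 0 < K)
    {W : X → Y → ℝ} (hW : IsKernel W)
    {φ : Decoder X Y n (expSize n R) (expSize n K)} {C : Codebook X n (expSize n R)}
    (hφ0 : ∀ c y m, 0 ≤ φ C c y m) (hφ1 : ∀ c y, ∑ m, φ C c y m ≤ 1) {τ : X × Y → ℕ}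
    (hτn : ∑ z, τ z = n) (hτ : ∀ z, τ z ≠ 0 → W z.1 z.2 ≠ 0) :
    1 / ((expSize n R : ℝ) * expSize n K) * ∑ y, typeContribution W φ C τ y ≤
      4 * (n * R + 2) * Real.exp (n * -jointObj W R K (typeDist n τ)) := by
  have hnR : 0 < n * R := mul_pos (Nat.cast_pos.2 (Nat.pos_of_ne_zero hn)) hR
  have hM0 : (0 : ℝ) < expSize n R := Nat.cast_pos.2 (Nat.pos_of_ne_zero (expSize_ne_zero n hR))
  have hN0 : (0 : ℝ) < expSize n K := Nat.cast_pos.2 (Nat.pos_of_ne_zero (expSize_ne_zero n hK))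
  have hφ : ∀ c y m, φ C c y m ≤ 1 := fun c y m =>
    (Finset.single_le_sum (f := φ C c y) (fun m _ => hφ0 c y m) (Finset.mem_univ m)).trans (hφ1 c y)
  have b1 := sum_typeContribution_le_exp hn hW hφ hτ
  have b2 := sum_typeContribution_le_add hn hW hφ0 hφ1 hτn hτ hnR.le (expSize_le n R)
  have hM := one_div_expSize_le n hR
  have hN := one_div_expSize_le n hK
  unfold jointObj
  set M : ℝ := ((expSize n R : ℕ) : ℝ)
  set N : ℝ := ((expSize n K : ℕ) : ℝ)
  set h := negEntropy (typeDist n τ)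
  set hx := negEntropy (margX (typeDist n τ))
  set hy := negEntropy (margY (typeDist n τ))
  set l := expLog (fun z => W z.1 z.2) (typeDist n τ)
  rcases max_cases 0 (R - (h - hx - hy) - max 0 (-l - K)) with ⟨hmax, -⟩ | ⟨hmax, -⟩
  · rw [hmax, add_zero]
    calc 1 / (M * N) * ∑ y, typeContribution W φ C τ y
        ≤ 1 / (M * N) * (M * N * Real.exp (n * -(h - hx - l))) := by gcongr
      _ = 1 * Real.exp (n * -(h - hx - l)) := by field_simp
      _ ≤ _ := by gcongr; linarith
  · rw [hmax]
    set b := max 0 (-l - K)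
    have hb0 : 0 ≤ b := le_max_left _ _
    have hb1 : -l - K ≤ b := le_max_right _ _
    have hnn : (0 : ℝ) ≤ n := Nat.cast_nonneg n
    calc 1 / (M * N) * ∑ y, typeContribution W φ C τ y
        ≤ 1 / (M * N) * (Real.exp (n * -hy) * (n * R + 1 + 2 * (N * Real.exp (n * l)))) := by
          gcongr
      _ = 1 / M * Real.exp (n * -hy) *
            ((n * R + 1) * (1 / N) + 2 * Real.exp (n * l)) := by field_simp
      _ ≤ 2 * Real.exp (-(n * R)) * Real.exp (n * -hy) *
            ((n * R + 1) * (2 * Real.exp (n * (l + b))) + 2 * Real.exp (n * (l + b))) := by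
          -- Since `b = |-l - K|⁺`, both `-K` and `l` are at most `l + b`; one exponential therefore
          -- covers both terms.
          have e1 : 1 / N ≤ 2 * Real.exp (n * (l + b)) := by
            refine hN.trans ?_
            gcongr
            nlinarith
          have e2 : Real.exp (n * l) ≤ Real.exp (n * (l + b)) := by
            gcongr
            linarith
          gcongr
      _ = 4 * (n * R + 2) * Real.exp (-(n * R) + n * -hy + n * (l + b)) := by
          rw [Real.exp_add, Real.exp_add]
          ring
      _ = _ := by
          congr 2
          ring

/-- Every decoder has correct-decoding probability at most `exp (-n E)` up to a polynomial factor,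
for every codebook. -/
theorem one_sub_errProb_le {n : ℕ} (hn : n ≠ 0) {R K : ℝ} (hR : 0 < R) (hK : 0 < K)
    {W : X → Y → ℝ} (hW : IsKernel W) {E : ℝ}
    (hE : ∀ Q ∈ dominatedBy fun z : X × Y => W z.1 z.2, E ≤ jointObj W R K Q)
    {φ : Decoder X Y n (expSize n R) (expSize n K)} {C : Codebook X n (expSize n R)}
    (hφ0 : ∀ c y m, 0 ≤ φ C c y m) (hφ1 : ∀ c y, ∑ m, φ C c y m ≤ 1) :
    1 - errProb W φ C ≤ ((n : ℝ) + 1) ^ (Fintype.card X * Fintype.card Y) *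
      (4 * (n * R + 2) * Real.exp (n * -E)) := by
  have hφ : ∀ c y m, φ C c y m ≤ 1 := fun c y m =>
    (Finset.single_le_sum (f := φ C c y) (fun m _ => hφ0 c y m) (Finset.mem_univ m)).trans (hφ1 c y)
  have hb : 0 ≤ 4 * (n * R + 2) * Real.exp (n * -E) := by positivity
  rw [one_sub_errProb (expSize_ne_zero n hR) (expSize_ne_zero n hK) hW, ← sum_typeContribution,
    Finset.mul_sum]
  have hcard : (((countSet X Y n).card : ℕ) : ℝ) =
      ((n : ℝ) + 1) ^ (Fintype.card X * Fintype.card Y) := by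
    rw [card_countSet]
    push_cast
    rfl
  rw [← hcard, ← nsmul_eq_mul (countSet X Y n).card]
  refine Finset.sum_le_card_nsmul _ _ _ fun τ _ => ?_
  -- `countSet` also contains counts of no pair of words, and some types charge zeros of `W`; both
  -- kinds contribute nothing.
  by_cases hxy : ∃ (y : Fin n → Y) (x : Fin n → X), jointCount x y = τ
  · obtain ⟨y, x, rfl⟩ := hxy
    set τ := jointCount x y
    have hτn : ∑ z, τ z = n := sum_jointCount x y
    by_cases hτ : ∀ z, τ z ≠ 0 → W z.1 z.2 ≠ 0
    · refine (typeContribution_div_le hn hR hK hW hφ0 hφ1 hτn hτ).trans ?_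
      have := hE (typeDist n τ)
        ⟨typeDist_mem hn hτn, fun z hz => hτ z ((typeDist_ne_zero hn).1 hz)⟩
      gcongr
    · refine le_trans (mul_nonpos_of_nonneg_of_nonpos (by positivity) ?_) hb
      refine Finset.sum_nonpos fun y' _ => (typeContribution_le_sum hW hφ τ y').trans ?_
      refine Finset.sum_nonpos fun m _ => ?_
      split_ifs with h
      · rw [wordProb_eq_zero h hτ, mul_zero]
      · exact le_rfl
  · push Not at hxy
    rw [Finset.sum_eq_zero fun y _ => typeContribution_eq_zero W φ C
      fun ⟨x, hx⟩ => hxy y x hx, mul_zero]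
    exact hb

/-! ### Uniform choice and optimality of maximum-likelihood decoding -/

theorem uniformChoice_nonneg {M : ℕ} (S : Finset (Fin M)) (m : Fin M) : 0 ≤ uniformChoice S m := by
  unfold uniformChoice
  split_ifs
  · positivity
  · exact le_rfl

theorem sum_mul_uniformChoice {M : ℕ} (S : Finset (Fin M)) (f : Fin M → ℝ) :
    ∑ m, f m * uniformChoice S m = (∑ m ∈ S, f m) / S.card := by
  unfold uniformChoice
  simp only [mul_ite, mul_zero]
  rw [Finset.sum_ite_mem, Finset.univ_inter, Finset.sum_div]
  exact Finset.sum_congr rfl fun m _ => by rw [mul_one_div]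

theorem sum_uniformChoice_le_one {M : ℕ} (S : Finset (Fin M)) : ∑ m, uniformChoice S m ≤ 1 := by
  have := sum_mul_uniformChoice S fun _ => 1
  simp only [one_mul] at this
  rw [this, Finset.sum_const, nsmul_eq_mul, mul_one]
  exact div_self_le_one _

theorem transProb_eq {n M N : ℕ} (c : Clouds Y n M N) (m : Fin M) (y : Fin n → Y) :
    transProb c m y = (replicas (c m) y : ℝ) / N := rfl

/-- A sub-probability average of replica counts is at most their maximum, which the uniform choice
among maximizers attains. -/
theorem sum_replicas_mul_le_ml {n M N : ℕ} (hM : M ≠ 0) (hN : N ≠ 0) (C : Codebook X n M)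
    (c : Clouds Y n M N) (y : Fin n → Y) {p : Fin M → ℝ} (hp0 : ∀ m, 0 ≤ p m)
    (hp1 : ∑ m, p m ≤ 1) :
    ∑ m, (replicas (c m) y : ℝ) * p m ≤
      ∑ m, (replicas (c m) y : ℝ) * mlDecoder X Y n M N C c y m := by
  classical
  have hN' : (0 : ℝ) < N := Nat.cast_pos.2 (Nat.pos_of_ne_zero hN)
  have : Nonempty (Fin M) := ⟨⟨0, Nat.pos_of_ne_zero hM⟩⟩
  obtain ⟨m₀, hm₀⟩ := Finite.exists_max fun m => replicas (c m) y
  unfold mlDecoder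
  rw [sum_mul_uniformChoice]
  set S := Finset.univ.filter fun m => ∀ m', transProb c m' y ≤ transProb c m y with hS
  have hmem : ∀ m, m ∈ S ↔ ∀ m', replicas (c m') y ≤ replicas (c m) y := by
    intro m
    rw [hS, Finset.mem_filter]
    simp only [Finset.mem_univ, true_and, transProb_eq]
    exact forall_congr' fun m' => by rw [div_le_div_iff_of_pos_right hN', Nat.cast_le]
  have hval : ∀ m ∈ S, (replicas (c m) y : ℝ) = replicas (c m₀) y := fun m hm => by
    rw [le_antisymm (hm₀ m) ((hmem m).1 hm m₀)]
  have hcard : (S.card : ℝ) ≠ 0 :=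
    Nat.cast_ne_zero.2 (Finset.card_ne_zero_of_mem ((hmem m₀).2 hm₀))
  rw [Finset.sum_congr rfl hval, Finset.sum_const, nsmul_eq_mul, mul_div_cancel_left₀ _ hcard]
  calc ∑ m, (replicas (c m) y : ℝ) * p m ≤ ∑ m, (replicas (c m₀) y : ℝ) * p m :=
        Finset.sum_le_sum fun m _ =>
          mul_le_mul_of_nonneg_right (Nat.cast_le.2 (hm₀ m)) (hp0 m)
    _ ≤ replicas (c m₀) y := by
        rw [← Finset.mul_sum]
        exact mul_le_of_le_one_right (Nat.cast_nonneg _) hp1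

theorem errProb_ml_le {n M N : ℕ} (hM : M ≠ 0) (hN : N ≠ 0) {W : X → Y → ℝ} (hW : IsKernel W)
    {φ : Decoder X Y n M N} {C : Codebook X n M} (hφ0 : ∀ c y m, 0 ≤ φ C c y m)
    (hφ1 : ∀ c y, ∑ m, φ C c y m ≤ 1) : errProb W (mlDecoder X Y n M N) C ≤ errProb W φ C := by
  rw [← sub_le_sub_iff_left 1, one_sub_errProb hM hN hW, one_sub_errProb hM hN hW]
  refine mul_le_mul_of_nonneg_left (Finset.sum_le_sum fun c _ => mul_le_mul_of_nonneg_left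
    (Finset.sum_le_sum fun y _ => ?_) (instanceProb_nonneg hW C c)) (by positivity)
  exact sum_replicas_mul_le_ml hM hN C c y (hφ0 c y) (hφ1 c y)

/-! ### Random codebooks -/

theorem sum_codebook (n M : ℕ) {P : X → ℝ} (hP : P ∈ stdSimplex ℝ X) :
    ∑ C : Codebook X n M, ∏ m, ∏ i, P (C m i) = 1 :=
  sum_pi_prod_eq_one (p := fun _ (x : Fin n → X) => ∏ i, P (x i)) fun _ =>
    sum_pi_prod_eq_one (p := fun _ => P) fun _ => hP.2

theorem one_sub_avgErrProb {n M N : ℕ} (W : X → Y → ℝ) (φ : Decoder X Y n M N) {P : X → ℝ}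
    (hP : P ∈ stdSimplex ℝ X) :
    1 - avgErrProb W φ P =
      ∑ C : Codebook X n M, (∏ m, ∏ i, P (C m i)) * (1 - errProb W φ C) := by
  simp only [mul_sub, mul_one, Finset.sum_sub_distrib, sum_codebook n M hP]
  rfl

theorem codebookProb_nonneg {n M : ℕ} {P : X → ℝ} (hP : P ∈ stdSimplex ℝ X)
    (C : Codebook X n M) : 0 ≤ ∏ m, ∏ i, P (C m i) :=
  Finset.prod_nonneg fun _ _ => Finset.prod_nonneg fun _ _ => hP.1 _

theorem avgErrProb_mono {n M N : ℕ} {W : X → Y → ℝ} {φ ψ : Decoder X Y n M N} {P : X → ℝ}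
    (hP : P ∈ stdSimplex ℝ X) (h : ∀ C, errProb W φ C ≤ errProb W ψ C) :
    avgErrProb W φ P ≤ avgErrProb W ψ P :=
  Finset.sum_le_sum fun C _ => mul_le_mul_of_nonneg_left (h C) (codebookProb_nonneg hP C)

theorem one_sub_avgErrProb_le {n M N : ℕ} {W : X → Y → ℝ} {φ : Decoder X Y n M N} {P : X → ℝ}
    (hP : P ∈ stdSimplex ℝ X) {b : ℝ} (h : ∀ C, 1 - errProb W φ C ≤ b) :
    1 - avgErrProb W φ P ≤ b := by
  rw [one_sub_avgErrProb W φ hP]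
  calc _ ≤ ∑ C : Codebook X n M, (∏ m, ∏ i, P (C m i)) * b :=
        Finset.sum_le_sum fun C _ => mul_le_mul_of_nonneg_left (h C) (codebookProb_nonneg hP C)
    _ = b := by rw [← Finset.sum_mul, sum_codebook n M hP, one_mul]

/-- The joint law of the codeword and the cloud of one message. -/
def messageProb {n N : ℕ} (W : X → Y → ℝ) (P : X → ℝ)
    (k : (Fin n → X) × (Fin N → Fin n → Y)) : ℝ :=
  (∏ i, P (k.1 i)) * cloudProb W k.1 k.2

theorem messageProb_nonneg {n N : ℕ} {W : X → Y → ℝ} (hW : IsKernel W) {P : X → ℝ}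
    (hP : P ∈ stdSimplex ℝ X) (k : (Fin n → X) × (Fin N → Fin n → Y)) :
    0 ≤ messageProb W P k :=
  mul_nonneg (Finset.prod_nonneg fun _ _ => hP.1 _) (cloudProb_nonneg hW _ _)

theorem sum_messageProb (n N : ℕ) {W : X → Y → ℝ} (hW : IsKernel W) {P : X → ℝ}
    (hP : P ∈ stdSimplex ℝ X) :
    ∑ k : (Fin n → X) × (Fin N → Fin n → Y), messageProb W P k = 1 := by
  rw [Fintype.sum_prod_type]
  simp only [messageProb, ← Finset.mul_sum, sum_cloudProb N hW, mul_one]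
  exact sum_pi_prod_eq_one (p := fun _ => P) fun _ => hP.2

/-- Pairing each codeword with its own cloud makes the data of the `M` messages i.i.d. with law
`messageProb`. -/
theorem one_sub_avgErrProb_eq_sum {n M N : ℕ} (hM : M ≠ 0) (hN : N ≠ 0) {W : X → Y → ℝ}
    (hW : IsKernel W) (φ : Decoder X Y n M N) {P : X → ℝ} (hP : P ∈ stdSimplex ℝ X) :
    1 - avgErrProb W φ P = 1 / ((M : ℝ) * N) * ∑ y, ∑ m,
      ∑ ω : Fin M → (Fin n → X) × (Fin N → Fin n → Y), (∏ m, messageProb W P (ω m)) *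
        ((replicas (ω m).2 y : ℝ) * φ (fun m => (ω m).1) (fun m => (ω m).2) y m) := by
  have e : ∑ y, ∑ m, ∑ ω : Fin M → (Fin n → X) × (Fin N → Fin n → Y),
      (∏ m, messageProb W P (ω m)) *
        ((replicas (ω m).2 y : ℝ) * φ (fun m => (ω m).1) (fun m => (ω m).2) y m) =
      ∑ ω : Fin M → (Fin n → X) × (Fin N → Fin n → Y), (∏ m, messageProb W P (ω m)) *
        ∑ y, ∑ m, (replicas (ω m).2 y : ℝ) * φ (fun m => (ω m).1) (fun m => (ω m).2) y m := by
    simp only [Finset.mul_sum]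
    rw [Finset.sum_congr rfl fun y _ => Finset.sum_comm, Finset.sum_comm]
  have e3 : ∑ ω : Fin M → (Fin n → X) × (Fin N → Fin n → Y), (∏ m, messageProb W P (ω m)) *
        ∑ y, ∑ m, (replicas (ω m).2 y : ℝ) * φ (fun m => (ω m).1) (fun m => (ω m).2) y m =
      ∑ w : Codebook X n M × Clouds Y n M N, (∏ m, messageProb W P (w.1 m, w.2 m)) *
        ∑ y, ∑ m, (replicas (w.2 m) y : ℝ) * φ w.1 w.2 y m :=
    Fintype.sum_equiv (Equiv.arrowProdEquivProdArrow (Fin M) (fun _ => Fin n → X)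
      fun _ => Fin N → Fin n → Y) _ _ fun ω => rfl
  rw [one_sub_avgErrProb W φ hP, e, e3, Fintype.sum_prod_type, Finset.mul_sum]
  refine Finset.sum_congr rfl fun C _ => ?_
  rw [one_sub_errProb hM hN hW, mul_left_comm, Finset.mul_sum]
  congr 1
  refine Finset.sum_congr rfl fun c _ => ?_
  rw [← mul_assoc, instanceProb_eq, ← Finset.prod_mul_distrib]
  rfl

/-! ### Random coding with the type decoder -/

open Classical in
/-- The event that a message is a candidate of the type decoder. -/
def candidate {n N : ℕ} (τ : X × Y → ℕ) (y : Fin n → Y)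
    (k : (Fin n → X) × (Fin N → Fin n → Y)) : ℝ :=
  if jointCount k.1 y = τ ∧ ∃ j, k.2 j = y then 1 else 0

open Classical in
/-- The number of replicas of `y` in the cloud if the codeword has the right joint type. -/
def typedReplicas {n N : ℕ} (τ : X × Y → ℕ) (y : Fin n → Y)
    (k : (Fin n → X) × (Fin N → Fin n → Y)) : ℝ :=
  if jointCount k.1 y = τ then (replicas k.2 y : ℝ) else 0

theorem typedReplicas_nonneg {n N : ℕ} (τ : X × Y → ℕ) (y : Fin n → Y)
    (k : (Fin n → X) × (Fin N → Fin n → Y)) : 0 ≤ typedReplicas τ y k := by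
  unfold typedReplicas
  split_ifs
  · exact Nat.cast_nonneg _
  · exact le_rfl

theorem exists_of_replicas_ne_zero {n N : ℕ} {c : Fin N → Fin n → Y} {y : Fin n → Y}
    (h : replicas c y ≠ 0) : ∃ j, c j = y := by
  classical
  obtain ⟨j, hj⟩ := Finset.card_ne_zero.1 h
  exact ⟨j, (Finset.mem_filter.1 hj).2⟩

/-- With `s` competitors the decoder succeeds with weight `1 / (1 + s)`. Its tangent at `s = μ`
bounds it from below and is affine in `s`, so its expectation needs only pairwise independence. -/
theorem typedReplicas_mul_le {n M N : ℕ} (τ : X × Y → ℕ) (y : Fin n → Y)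
    (ω : Fin M → (Fin n → X) × (Fin N → Fin n → Y)) (m : Fin M) {μ : ℝ} (hμ : 0 ≤ μ) :
    typedReplicas τ y (ω m) * (1 + 2 * μ - ∑ m' ∈ Finset.univ.erase m, candidate τ y (ω m')) /
        (1 + μ) ^ 2 ≤
      (replicas (ω m).2 y : ℝ) *
        typeDecoder τ (fun m => (ω m).1) (fun m => (ω m).2) y m := by
  classical
  by_cases h : jointCount (ω m).1 y = τ
  swap
  · rw [typedReplicas, if_neg h, zero_mul, zero_div]
    exact mul_nonneg (Nat.cast_nonneg _) (uniformChoice_nonneg _ _)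
  by_cases hr : replicas (ω m).2 y = 0
  · rw [typedReplicas, if_pos h, hr]
    simp
  unfold typeDecoder
  set S := Finset.univ.filter fun m =>
    jointCount (ω m).1 y = τ ∧ ∃ j, (ω m).2 j = y with hS
  have hmS : m ∈ S := by
    rw [hS, Finset.mem_filter]
    exact ⟨Finset.mem_univ _, h, exists_of_replicas_ne_zero hr⟩
  have hcard : (S.card : ℝ) = 1 + ∑ m' ∈ Finset.univ.erase m, candidate τ y (ω m') := by
    have h1 : (S.card : ℝ) = ∑ m', candidate τ y (ω m') := by
      rw [hS, ← Finset.sum_boole]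
      unfold candidate
      refine Finset.sum_congr rfl fun m' _ => ?_
      congr
    rw [h1, ← Finset.add_sum_erase _ _ (Finset.mem_univ m)]
    congr 1
    rw [candidate, if_pos (Finset.mem_filter.1 hmS).2]
  have hpos : (0 : ℝ) < S.card := Nat.cast_pos.2 (Finset.card_pos.2 ⟨m, hmS⟩)
  rw [typedReplicas, if_pos h, uniformChoice, if_pos hmS, mul_div_assoc]
  refine mul_le_mul_of_nonneg_left ?_ (Nat.cast_nonneg _)
  rw [div_le_div_iff₀ (by positivity) hpos]
  have e : ∑ m' ∈ Finset.univ.erase m, candidate τ y (ω m') = S.card - 1 := by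
    rw [hcard]
    ring
  rw [e]
  -- The inequality `(1 + 2μ - s)(1 + s) ≤ (1 + μ)²` is `(s - μ)² ≥ 0`, with `s = S.card - 1`.
  nlinarith [sq_nonneg ((S.card : ℝ) - 1 - μ)]

theorem sum_messageProb_mul_typedReplicas {n N : ℕ} {W : X → Y → ℝ} (hW : IsKernel W)
    (P : X → ℝ) (τ : X × Y → ℕ) (y : Fin n → Y) [DecidableEq (X × Y → ℕ)] :
    ∑ k : (Fin n → X) × (Fin N → Fin n → Y), messageProb W P k * typedReplicas τ y k =
      N * ∑ x : Fin n → X,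
        if jointCount x y = τ then ∏ i, jointXY P W (x i, y i) else 0 := by
  rw [Fintype.sum_prod_type, Finset.mul_sum]
  refine Finset.sum_congr rfl fun x _ => ?_
  unfold typedReplicas messageProb
  by_cases h : jointCount x y = τ
  · simp only [if_pos h, mul_assoc]
    rw [← Finset.mul_sum, sum_cloudProb_mul_replicas hW, mul_left_comm, wordProb,
      ← Finset.prod_mul_distrib]
    rfl
  · simp [h]

open Classical in
-- Given the codeword, the chance that `y` occurs is at most `1` and, by Markov's inequality, at
-- most the mean replica count.
theorem sum_messageProb_mul_candidate_le {n N : ℕ} {W : X → Y → ℝ} (hW : IsKernel W)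
    {P : X → ℝ} (hP : P ∈ stdSimplex ℝ X) (τ : X × Y → ℕ) (y : Fin n → Y) :
    ∑ k : (Fin n → X) × (Fin N → Fin n → Y), messageProb W P k * candidate τ y k ≤
      ∑ x : Fin n → X with jointCount x y = τ, (∏ i, P (x i)) * min 1 (N * wordProb W x y) := by
  rw [Fintype.sum_prod_type, Finset.sum_filter]
  refine Finset.sum_le_sum fun x _ => ?_
  unfold candidate messageProb
  by_cases h : jointCount x y = τ
  · simp only [h, true_and, if_true, mul_assoc]
    rw [← Finset.mul_sum]
    refine mul_le_mul_of_nonneg_left (le_min ?_ ?_) (Finset.prod_nonneg fun _ _ => hP.1 _)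
    · refine le_trans ?_ (sum_cloudProb N hW x).le
      refine Finset.sum_le_sum fun c _ => mul_le_of_le_one_right (cloudProb_nonneg hW x c) ?_
      split_ifs <;> norm_num
    · rw [← sum_cloudProb_mul_replicas hW]
      refine Finset.sum_le_sum fun c _ => mul_le_mul_of_nonneg_left ?_ (cloudProb_nonneg hW x c)
      split_ifs with hj
      · obtain ⟨j, hj⟩ := hj
        rw [Nat.one_le_cast, Nat.one_le_iff_ne_zero]
        exact Finset.card_ne_zero_of_mem (Finset.mem_filter.2 ⟨Finset.mem_univ j, hj⟩)
      · exact Nat.cast_nonneg _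
  · simp [h]

open Classical in
/-- The correct-decoding probability of the type decoder under random coding. -/
theorem typeProb_div_le_one_sub_avgErrProb {n M N : ℕ} (hM : M ≠ 0) (hN : N ≠ 0) {W : X → Y → ℝ}
    (hW : IsKernel W) {P : X → ℝ} (hP : P ∈ stdSimplex ℝ X) (τ : X × Y → ℕ) {μ : ℝ} (hμ : 0 ≤ μ)
    (h : ∀ y : Fin n → Y, M * ∑ x : Fin n → X with jointCount x y = τ,
      (∏ i, P (x i)) * min 1 (N * wordProb W x y) ≤ μ) :
    typeProb n (jointXY P W) τ / (1 + μ) ≤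
      1 - avgErrProb W (typeDecoder τ : Decoder X Y n M N) P := by
  have hM' : (M : ℝ) ≠ 0 := Nat.cast_ne_zero.2 hM
  have hN' : (N : ℝ) ≠ 0 := Nat.cast_ne_zero.2 hN
  set π : (Fin n → X) × (Fin N → Fin n → Y) → ℝ := messageProb W P with hπ
  have hπ1 : ∑ k, π k = 1 := sum_messageProb n N hW hP
  have hπ0 : ∀ k, 0 ≤ π k := messageProb_nonneg hW hP
  have key : ∀ (y : Fin n → Y) (m : Fin M), (∑ k, π k * typedReplicas τ y k) / (1 + μ) ≤
      ∑ ω : Fin M → (Fin n → X) × (Fin N → Fin n → Y), (∏ m, π (ω m)) *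
        ((replicas (ω m).2 y : ℝ) *
          typeDecoder τ (fun m => (ω m).1) (fun m => (ω m).2) y m) := by
    intro y m
    set g := ∑ k, π k * typedReplicas τ y k with hg
    set q := ∑ k, π k * candidate τ y k with hq
    have hg0 : 0 ≤ g := Finset.sum_nonneg fun k _ =>
      mul_nonneg (hπ0 k) (typedReplicas_nonneg τ y k)
    have hq0 : 0 ≤ q := Finset.sum_nonneg fun k _ => mul_nonneg (hπ0 k) (by
      unfold candidate
      split_ifs <;> norm_num)
    have hMq : M * q ≤ μ := le_trans (mul_le_mul_of_nonneg_left
      (sum_messageProb_mul_candidate_le hW hP τ y) (Nat.cast_nonneg _)) (h y)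
    have h1 : ∑ ω : Fin M → (Fin n → X) × (Fin N → Fin n → Y),
        (∏ m, π (ω m)) * typedReplicas τ y (ω m) = g :=
      sum_pi_prod_mul_apply (p := fun _ => π) (fun _ => hπ1) m _
    -- The codeword and cloud of a competitor are independent of those of `m`.
    have h2 : ∀ m' ∈ Finset.univ.erase m, ∑ ω : Fin M → (Fin n → X) × (Fin N → Fin n → Y),
        (∏ m, π (ω m)) * (typedReplicas τ y (ω m) * candidate τ y (ω m')) = g * q :=
      fun m' hm' => sum_pi_prod_mul_apply_mul_apply (p := fun _ => π) (fun _ => hπ1)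
        (Finset.ne_of_mem_erase hm') _ _
    calc g / (1 + μ) = g * (1 + μ) / (1 + μ) ^ 2 := by field_simp
      _ ≤ (g * (1 + 2 * μ) - ((Finset.univ.erase m).card : ℝ) * (g * q)) / (1 + μ) ^ 2 := by
          have hc : ((Finset.univ.erase m).card : ℝ) ≤ M := by
            rw [Nat.cast_le]
            exact (Finset.card_le_univ _).trans (Fintype.card_fin M).le
          have := mul_le_mul_of_nonneg_right hc hq0
          gcongr
          nlinarith
      _ = ∑ ω : Fin M → (Fin n → X) × (Fin N → Fin n → Y), (∏ m, π (ω m)) *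
            (typedReplicas τ y (ω m) *
              (1 + 2 * μ - ∑ m' ∈ Finset.univ.erase m, candidate τ y (ω m')) /
                (1 + μ) ^ 2) := by
          rw [← h1, Finset.sum_mul, h1, ← nsmul_eq_mul, ← Finset.sum_const,
            ← Finset.sum_congr rfl h2, Finset.sum_comm, ← Finset.sum_sub_distrib, Finset.sum_div]
          refine Finset.sum_congr rfl fun ω _ => ?_
          rw [← Finset.mul_sum, ← Finset.mul_sum]
          ring
      _ ≤ _ := Finset.sum_le_sum fun ω _ => mul_le_mul_of_nonneg_left
          (typedReplicas_mul_le τ y ω m hμ) (Finset.prod_nonneg fun _ _ => hπ0 _)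
  rw [one_sub_avgErrProb_eq_sum hM hN hW _ hP]
  calc typeProb n (jointXY P W) τ / (1 + μ)
      = 1 / ((M : ℝ) * N) * ∑ y : Fin n → Y, ∑ _m : Fin M,
          (∑ k, π k * typedReplicas τ y k) / (1 + μ) := by
        simp only [hπ, sum_messageProb_mul_typedReplicas hW, Finset.sum_const, Finset.card_univ,
          Fintype.card_fin, nsmul_eq_mul, mul_div_assoc, ← Finset.mul_sum, ← Finset.sum_div]
        rw [typeProb, Finset.sum_comm]
        field_simp
    _ ≤ _ := by
        gcongr with y _ m _
        exact key y m

/-! ### Exponents -/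

theorem tendsto_log_div (a b : ℝ) :
    Tendsto (fun n : ℕ => (a * Real.log ((n : ℝ) + 1) + b) / n) atTop (𝓝 0) := by
  have h1 : Tendsto (fun n : ℕ => Real.log ((n : ℝ) + 1) / n) atTop (𝓝 0) := by
    have := (Real.tendsto_pow_log_div_mul_add_atTop 1 (-1) 1 one_ne_zero).comp
      (tendsto_atTop_add_const_right atTop (1 : ℝ) tendsto_natCast_atTop_atTop)
    refine this.congr fun n => ?_
    simp
  have h2 : Tendsto (fun n : ℕ => b / (n : ℝ)) atTop (𝓝 0) :=
    tendsto_const_div_atTop_nhds_zero_nat b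
  have := (h1.const_mul a).add h2
  rw [mul_zero, add_zero] at this
  refine this.congr fun n => ?_
  rw [add_div, mul_div_assoc]

theorem expo_anti (n : ℕ) {p q : ℝ} (hp : 0 < p) (hpq : p ≤ q) : expo n q ≤ expo n p := by
  unfold expo
  rw [neg_mul, neg_mul, neg_le_neg_iff]
  exact mul_le_mul_of_nonneg_left (Real.log_le_log hp hpq) (by positivity)

theorem expo_exp {n : ℕ} (hn : n ≠ 0) (e a b : ℝ) :
    expo n (Real.exp (n * -e + (a * Real.log ((n : ℝ) + 1) + b))) =
      e - (a * Real.log ((n : ℝ) + 1) + b) / n := by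
  have hn' : (n : ℝ) ≠ 0 := Nat.cast_ne_zero.2 hn
  unfold expo
  rw [Real.log_exp]
  field_simp
  ring

theorem natCast_add_one_pow_eq_exp (n k : ℕ) :
    ((n : ℝ) + 1) ^ k = Real.exp (k * Real.log ((n : ℝ) + 1)) := by
  rw [Real.exp_nat_mul, Real.exp_log (by positivity)]

/-- Types that carry a polynomially large share of the probability converge to the law. -/
theorem tendsto_typeDist {q : X × Y → ℝ} (hq : q ∈ stdSimplex ℝ (X × Y)) {k : ℕ}
    {τ : ℕ → X × Y → ℕ} (hτ : ∀ n, ∑ z, τ n z = n) (hpos : ∀ n z, τ n z ≠ 0 → 0 < q z)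
    (hge : ∀ n : ℕ, 1 ≤ ((n : ℝ) + 1) ^ k * typeProb n q (τ n)) :
    Tendsto (fun n => typeDist n (τ n)) atTop (𝓝 q) := by
  rw [tendsto_pi_nhds]
  intro z
  have hb : ∀ᶠ n : ℕ in atTop, (√(typeDist n (τ n) z) - √(q z)) ^ 2 ≤
      (k * Real.log ((n : ℝ) + 1) + 0) / n := by
    filter_upwards [eventually_ne_atTop 0] with n hn
    have hn' : (0 : ℝ) < n := Nat.cast_pos.2 (Nat.pos_of_ne_zero hn)
    have h1 := sum_sq_sqrt_sub_le (typeDist_mem hn (hτ n)) hq.1 hq.2.le fun a ha =>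
      (hpos n a ((typeDist_ne_zero hn).1 ha)).ne'
    have h2 := Finset.single_le_sum (f := fun a => (√(typeDist n (τ n) a) - √(q a)) ^ 2)
      (fun a _ => sq_nonneg _) (Finset.mem_univ z)
    -- A polynomially large probability bounds the divergence of the type from `q` by `k log (n + 1)
    -- / n`, and the Hellinger bound passes this on to each coordinate.
    have h3 := (hge n).trans (mul_le_mul_of_nonneg_left
      (typeProb_le_exp hn (hτ n) (hpos n)) (by positivity))
    rw [natCast_add_one_pow_eq_exp, ← Real.exp_add, Real.one_le_exp_iff] at h3
    rw [le_div_iff₀ hn']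
    have h4 := mul_le_mul_of_nonneg_right (h2.trans h1) hn'.le
    linarith
  have hsq := squeeze_zero' (Eventually.of_forall fun n => sq_nonneg _) hb (tendsto_log_div k 0)
  have habs := hsq.sqrt
  simp only [Real.sqrt_sq_eq_abs, Real.sqrt_zero] at habs
  have hs : Tendsto (fun n => √(typeDist n (τ n) z)) atTop (𝓝 √(q z)) := by
    have := (tendsto_zero_iff_abs_tendsto_zero _).2 habs
    simpa using this.add_const √(q z)
  have := hs.pow 2
  rw [Real.sq_sqrt (hq.1 z)] at this
  refine this.congr fun n => Real.sq_sqrt ?_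
  unfold typeDist
  positivity

theorem typeDecoder_nonneg {n M N : ℕ} (τ : X × Y → ℕ) (C : Codebook X n M)
    (c : Clouds Y n M N) (y : Fin n → Y) (m : Fin M) : 0 ≤ typeDecoder τ C c y m :=
  uniformChoice_nonneg _ _

theorem sum_typeDecoder_le_one {n M N : ℕ} (τ : X × Y → ℕ) (C : Codebook X n M)
    (c : Clouds Y n M N) (y : Fin n → Y) : ∑ m, typeDecoder τ C c y m ≤ 1 :=
  sum_uniformChoice_le_one _

theorem mlDecoder_nonneg {n M N : ℕ} (C : Codebook X n M)
    (c : Clouds Y n M N) (y : Fin n → Y) (m : Fin M) : 0 ≤ mlDecoder X Y n M N C c y m :=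
  uniformChoice_nonneg _ _

theorem sum_mlDecoder_le_one {n M N : ℕ} (C : Codebook X n M)
    (c : Clouds Y n M N) (y : Fin n → Y) : ∑ m, mlDecoder X Y n M N C c y m ≤ 1 :=
  sum_uniformChoice_le_one _

/-- Guessing the message bounds the error probability of maximum-likelihood decoding. -/
theorem one_sub_errProb_ml_pos {n M N : ℕ} (hM : M ≠ 0) (hN : N ≠ 0) {W : X → Y → ℝ}
    (hW : IsKernel W) (C : Codebook X n M) : 0 < 1 - errProb W (mlDecoder X Y n M N) C := by
  have hM' : (M : ℝ) ≠ 0 := Nat.cast_ne_zero.2 hM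
  have hN' : (N : ℝ) ≠ 0 := Nat.cast_ne_zero.2 hN
  have h := errProb_ml_le (C := C) hM hN hW (φ := fun _ _ _ _ => 1 / (M : ℝ))
    (fun _ _ _ => by positivity) (fun _ _ => by simp [hM'])
  have e : errProb W (fun _ _ _ _ => 1 / (M : ℝ) : Decoder X Y n M N) C = 1 - 1 / M := by
    unfold errProb
    simp only [Finset.sum_const, Finset.card_univ, Fintype.card_fin, nsmul_eq_mul,
      ← Finset.sum_mul, sum_instanceProb N hW]
    field_simp
  have : 0 < 1 / (M : ℝ) := by positivity
  linarith

/-- The exponent of a type decoder for types near `Q`, as a function of the type. -/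
def typeExponent (W : X → Y → ℝ) (P : X → ℝ) (R K : ℝ) (Q t : X × Y → ℝ) : ℝ :=
  expLog Q t - expLog (jointXY P W) t +
    max 0 (R - (expLog (fun z => Q z / margY Q z.2) t - expLog (fun z => P z.1) t) -
      max 0 (-expLog (fun z => W z.1 z.2) t - K))

theorem continuous_typeExponent (W : X → Y → ℝ) (P : X → ℝ) (R K : ℝ) (Q : X × Y → ℝ) :
    Continuous (typeExponent W P R K Q) := by
  have h1 := continuous_expLog Q
  have h2 := continuous_expLog (jointXY P W)
  have h3 := continuous_expLog fun z : X × Y => Q z / margY Q z.2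
  have h4 := continuous_expLog fun z : X × Y => P z.1
  have h5 := continuous_expLog fun z : X × Y => W z.1 z.2
  unfold typeExponent
  fun_prop

/-- At `t = Q` the fixed logarithms are averaged under their own law and become entropies; this
identifies the limit of the exponents. -/
theorem typeExponent_self {W : X → Y → ℝ} {P : X → ℝ} (R K : ℝ) {Q : X × Y → ℝ}
    (hQ : Q ∈ dominatedBy (jointXY P W)) :
    typeExponent W P R K Q Q = jointObjP W P R K Q := by
  have e1 : expLog (jointXY P W) Q = expLog (fun z => P z.1) Q + expLog (fun z => W z.1 z.2) Q :=
    expLog_mul (fun z hz => left_ne_zero_of_mul (hQ.2 z hz))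
      fun z hz => right_ne_zero_of_mul (hQ.2 z hz)
  have e2 : expLog (fun z => Q z / margY Q z.2) Q = negEntropy Q - negEntropy (margY Q) := by
    rw [expLog_div (fun z hz => hz) fun z hz => (margY_pos hQ.1.1 hz).ne', expLog_margY]
    rfl
  have e3 : expLog Q Q = negEntropy Q := rfl
  unfold typeExponent jointObjP
  rw [e1, e2, e3]
  ring_nf

/-- Non-asymptotic achievability. -/
theorem exp_le_one_sub_PeRandomType {n : ℕ} (hn : n ≠ 0) {R K : ℝ} (hR : 0 < R) (hK : 0 < K)
    {W : X → Y → ℝ} (hW : IsKernel W) {P : X → ℝ} (hP : P ∈ stdSimplex ℝ X) {Q : X × Y → ℝ}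
    (hQ : Q ∈ dominatedBy (jointXY P W)) {k : ℕ} {τ : X × Y → ℕ}
    (hpos : ∀ z, τ z ≠ 0 → 0 < Q z) (hge : 1 ≤ ((n : ℝ) + 1) ^ k * typeProb n Q τ) :
    Real.exp (n * -typeExponent W P R K Q (typeDist n τ) +
      (-k * Real.log ((n : ℝ) + 1) + -Real.log 2)) ≤ 1 - PeRandomType W R K P n τ := by
  classical
  have hPW : ∀ z, τ z ≠ 0 → 0 < jointXY P W z := fun z hz =>
    ((jointXY_mem hP hW).1 z).lt_of_ne' (hQ.2 z (hpos z hz).ne')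
  have hP0 : ∀ z, τ z ≠ 0 → 0 < P z.1 := fun z hz =>
    (hP.1 _).lt_of_ne' (left_ne_zero_of_mul (hPW z hz).ne')
  have hW0 : ∀ z, τ z ≠ 0 → W z.1 z.2 ≠ 0 := fun z hz => right_ne_zero_of_mul (hPW z hz).ne'
  have hnn : (0 : ℝ) ≤ n := Nat.cast_nonneg n
  set t := typeDist n τ with ht
  set l := expLog (fun z => W z.1 z.2) t with hl
  set v := expLog (fun z => Q z / margY Q z.2) t with hv
  set p := expLog (fun z => P z.1) t with hp
  set s := R - (v - p) - max 0 (-l - K) with hs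
  -- The inner positive part arises here: a cloud contains `y` with probability at most `1` or `exp
  -- (n (K + l))`, whichever is smaller.
  have hmin : min 1 ((expSize n K : ℝ) * Real.exp (n * l)) ≤
      Real.exp (n * -max 0 (-l - K)) := by
    rcases max_cases 0 (-l - K) with ⟨h, -⟩ | ⟨h, -⟩
    · rw [h]
      simp
    · rw [h]
      refine (min_le_right _ _).trans ?_
      calc (expSize n K : ℝ) * Real.exp (n * l) ≤ Real.exp (n * K) * Real.exp (n * l) := by
            gcongr
            exact expSize_le n K
        _ = _ := by
            rw [← Real.exp_add]
            congr 1
            ring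
  have hμ : ∀ y : Fin n → Y, (expSize n R : ℝ) * ∑ x : Fin n → X with jointCount x y = τ,
      (∏ i, P (x i)) * min 1 (expSize n K * wordProb W x y) ≤ Real.exp (n * s) := by
    intro y
    -- The auxiliary kernel is that of the limit law `Q`, not of the type, so that the exponent
    -- involves `t` only through expectations of fixed functions.
    have hc := sum_condType_prod_le hn y hP0 (V := fun z => Q z / margY Q z.2)
      (fun z hz => div_pos (hpos z hz) (margY_pos hQ.1.1 (hpos z hz).ne'))
      (fun z => div_nonneg (hQ.1.1 z) ((margY_mem hQ.1).1 _))
      (fun b => (Finset.sum_div Finset.univ (fun a => Q (a, b)) (margY Q b)).symm.trans_le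
        (div_self_le_one _))
    calc (expSize n R : ℝ) * ∑ x : Fin n → X with jointCount x y = τ,
          (∏ i, P (x i)) * min 1 (expSize n K * wordProb W x y)
        ≤ Real.exp (n * R) * ∑ x : Fin n → X with jointCount x y = τ,
          (∏ i, P (x i)) * Real.exp (n * -max 0 (-l - K)) := by
          refine mul_le_mul (expSize_le n R) (Finset.sum_le_sum fun x hx => ?_)
            (Finset.sum_nonneg fun x _ => mul_nonneg (Finset.prod_nonneg fun _ _ => hP.1 _)
              (le_min zero_le_one (mul_nonneg (Nat.cast_nonneg _) (wordProb_nonneg hW _ _))))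
            (Real.exp_pos _).le
          refine mul_le_mul_of_nonneg_left ?_ (Finset.prod_nonneg fun _ _ => hP.1 _)
          rw [wordProb_eq_exp hn hW (Finset.mem_filter.1 hx).2 hW0]
          exact hmin
      _ ≤ Real.exp (n * R) * (Real.exp (n * (p - v)) * Real.exp (n * -max 0 (-l - K))) := by
          rw [← Finset.sum_mul]
          gcongr
      _ = Real.exp (n * s) := by
          rw [← Real.exp_add, ← Real.exp_add, hs]
          congr 1
          ring
  have main := typeProb_div_le_one_sub_avgErrProb (expSize_ne_zero n hR) (expSize_ne_zero n hK) hW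
    hP τ (Real.exp_pos (n * s)).le (fun y => by convert hμ y)
  refine le_trans ?_ main
  rw [typeProb_eq_mul hn hPW hpos, ← ht, le_div_iff₀ (by positivity)]
  have h2 : 1 + Real.exp (n * s) ≤ 2 * Real.exp (n * max 0 s) := by
    have h0 : 1 ≤ Real.exp (n * max 0 s) :=
      Real.one_le_exp (mul_nonneg hnn (le_max_left _ _))
    have h1 : Real.exp (n * s) ≤ Real.exp (n * max 0 s) := by
      gcongr
      exact le_max_right _ _
    linarith
  have h3 : Real.exp (-k * Real.log ((n : ℝ) + 1)) ≤ typeProb n Q τ := by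
    rw [neg_mul, Real.exp_neg, ← natCast_add_one_pow_eq_exp]
    rwa [inv_le_iff_one_le_mul₀' (by positivity)]
  calc Real.exp (n * -typeExponent W P R K Q t + (-k * Real.log ((n : ℝ) + 1) + -Real.log 2)) *
        (1 + Real.exp (n * s))
      ≤ Real.exp (n * -typeExponent W P R K Q t +
          (-k * Real.log ((n : ℝ) + 1) + -Real.log 2)) * (2 * Real.exp (n * max 0 s)) := by
        gcongr
    _ = Real.exp (n * (expLog (jointXY P W) t - expLog Q t)) *
          Real.exp (-k * Real.log ((n : ℝ) + 1)) := by
        have e2 : (2 : ℝ) = Real.exp (Real.log 2) := (Real.exp_log two_pos).symm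
        nth_rewrite 2 [e2]
        rw [← Real.exp_add, ← Real.exp_add, ← Real.exp_add, typeExponent, ← hl, ← hv, ← hp, ← hs]
        congr 1
        ring
    _ ≤ _ := by gcongr

/-- The converse bound in exponential form. -/
theorem one_sub_errProb_le_exp {n : ℕ} (hn : n ≠ 0) {R K : ℝ} (hR : 0 < R) (hK : 0 < K)
    {W : X → Y → ℝ} (hW : IsKernel W) {E : ℝ}
    (hE : ∀ Q ∈ dominatedBy fun z : X × Y => W z.1 z.2, E ≤ jointObj W R K Q)
    (C : Codebook X n (expSize n R)) :
    1 - Pe W K C ≤ Real.exp (n * -E + (((Fintype.card X * Fintype.card Y + 1 : ℕ) : ℝ) *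
      Real.log ((n : ℝ) + 1) + Real.log (4 * (R + 2)))) := by
  refine (one_sub_errProb_le hn hR hK hW hE (mlDecoder_nonneg C)
    (sum_mlDecoder_le_one C)).trans ?_
  rw [Real.exp_add, Real.exp_add, ← natCast_add_one_pow_eq_exp, Real.exp_log (by positivity),
    pow_succ]
  have hnn : (0 : ℝ) ≤ n := Nat.cast_nonneg n
  -- The linear factor is absorbed into one more power of `n + 1`; hence the `+ 1` in the statement.
  have h : 4 * (n * R + 2) ≤ ((n : ℝ) + 1) * (4 * (R + 2)) := by nlinarith
  calc ((n : ℝ) + 1) ^ (Fintype.card X * Fintype.card Y) *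
        (4 * (n * R + 2) * Real.exp (n * -E))
      ≤ ((n : ℝ) + 1) ^ (Fintype.card X * Fintype.card Y) *
        (((n : ℝ) + 1) * (4 * (R + 2)) * Real.exp (n * -E)) := by gcongr
    _ = _ := by ring

/-- Random-coding argument: the best codebook does at least as well as the average. -/
theorem exists_one_sub_avgErrProb_le [Nonempty X] {n M N : ℕ} {W : X → Y → ℝ}
    {φ : Decoder X Y n M N} {P : X → ℝ} (hP : P ∈ stdSimplex ℝ X) :
    ∃ C : Codebook X n M, 1 - avgErrProb W φ P ≤ 1 - errProb W φ C := by
  obtain ⟨C, hC⟩ := Finite.exists_max fun C : Codebook X n M => 1 - errProb W φ C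
  exact ⟨C, one_sub_avgErrProb_le hP hC⟩

theorem PeRandom_le_PeRandomType {n : ℕ} {R K : ℝ} (hR : 0 < R) (hK : 0 < K)
    {W : X → Y → ℝ} (hW : IsKernel W) {P : X → ℝ} (hP : P ∈ stdSimplex ℝ X) (τ : X × Y → ℕ) :
    PeRandom W R K P n ≤ PeRandomType W R K P n τ :=
  avgErrProb_mono hP fun C => errProb_ml_le (expSize_ne_zero n hR) (expSize_ne_zero n hK) hW
    (typeDecoder_nonneg τ C) (sum_typeDecoder_le_one τ C)

/-- Matching bounds on all correct-decoding probabilities for a distribution `P` that attains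
the optimal exponent. -/
theorem exists_exponent_bounds [Nonempty X] {W : X → Y → ℝ} (hW : IsKernel W) {R K : ℝ}
    (hR : 0 < R) (hK : 0 < K) {P : X → ℝ} (hP : P ∈ stdSimplex ℝ X)
    (hEP : EcP W P R K = Ec W R K) :
    ∃ (E : ℝ) (lo hi : ℕ → ℝ) (τ : ℕ → X × Y → ℕ), Ec W R K = (E : EReal) ∧
      Tendsto lo atTop (𝓝 E) ∧ Tendsto hi atTop (𝓝 E) ∧ (∀ n, ∑ z, τ n z = n) ∧
      ∀ n, n ≠ 0 → 0 < 1 - PeRandomType W R K P n (τ n) ∧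
        expo n (1 - PeRandomType W R K P n (τ n)) ≤ hi n ∧
        ∀ C : Codebook X n (expSize n R), lo n ≤ expo n (1 - Pe W K C) := by
  obtain ⟨Q₀, hQ₀, hmin₀⟩ := exists_jointObj_min hW R K
  obtain ⟨Q, hQ, hmin⟩ := exists_jointObjP_min hW hP R K
  have hE₀ := (Ec_eq_of_isMin hW R K hQ₀ hmin₀).1
  have hE := (EcP_eq_of_isMin hP R K hQ hmin).1
  have hEE : jointObjP W P R K Q = jointObj W R K Q₀ := by
    rw [hE, hE₀] at hEP
    exact_mod_cast hEP
  -- The types are typical for the minimizer `Q`, not for `PW`; the price of the mismatch is the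
  -- divergence term of the objective.
  choose τ hτ hpos hge using fun n => exists_typeProb_ge n hQ.1
  have hlim := tendsto_typeDist hQ.1 hτ hpos hge
  refine ⟨jointObj W R K Q₀, fun n => jointObj W R K Q₀ -
      (((Fintype.card X * Fintype.card Y + 1 : ℕ) : ℝ) * Real.log ((n : ℝ) + 1) +
        Real.log (4 * (R + 2))) / n,
    fun n => typeExponent W P R K Q (typeDist n (τ n)) -
      (-((Fintype.card X * Fintype.card Y : ℕ) : ℝ) * Real.log ((n : ℝ) + 1) +
        -Real.log 2) / n, τ, hE₀, ?_, ?_, hτ, fun n hn => ?_⟩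
  rotate_left 2
  · have hl := exp_le_one_sub_PeRandomType hn hR hK hW hP hQ (hpos n) (hge n)
    refine ⟨(Real.exp_pos _).trans_le hl, ?_, fun C => ?_⟩
    · refine (expo_anti n (Real.exp_pos _) hl).trans (le_of_eq ?_)
      exact expo_exp hn _ _ _
    -- Positivity is essential, because `Real.log 0 = 0` would give a vanishing success probability
    -- the exponent `0`.
    · refine le_trans (le_of_eq ?_) (expo_anti n (one_sub_errProb_ml_pos (expSize_ne_zero n hR)
        (expSize_ne_zero n hK) hW C) (one_sub_errProb_le_exp hn hR hK hW hmin₀ C))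
      exact (expo_exp hn _ _ _).symm
  · simpa only [sub_zero] using (tendsto_const_nhds (x := jointObj W R K Q₀)).sub
      (tendsto_log_div _ _)
  · have h1 := ((continuous_typeExponent W P R K Q).tendsto Q).comp hlim
    rw [typeExponent_self R K hQ, hEE] at h1
    simpa only [sub_zero, Function.comp_def] using h1.sub (tendsto_log_div _ _)

end

theorem theorem4 {X Y : Type*} [Fintype X] [Fintype Y] [Nonempty X]
    (W : X → Y → ℝ) (hW : IsKernel W) (R K : ℝ) (hR : 0 < R) (hK : 0 < K) :
    -- the minima defining `E_c(R, K)` and `E_c(P, R, K)` are attained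
    (∃ P ∈ stdSimplex ℝ X, ∃ U : X → Y → ℝ, IsKernel U ∧ EcObj W R K P U = Ec W R K) ∧
    (∀ P ∈ stdSimplex ℝ X, ∃ T ∈ stdSimplex ℝ Y, ∃ V : Y → X → ℝ,
      IsKernel V ∧ EcPObj W P R K T V = EcP W P R K) ∧
    -- `E_c(R, K) = min_P E_c(P, R, K)`
    IsLeast ((fun P => EcP W P R K) '' stdSimplex ℝ X) (Ec W R K) ∧
    -- the optimal exponent over all codebooks (a minimum over a finite set) converges to it
    Tendsto (fun n : ℕ => ⨅ C : Codebook X n (expSize n R), ((expo n (1 - Pe W K C) : ℝ) : EReal))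
      atTop (𝓝 (Ec W R K)) ∧
    -- random coding with any minimizing `P` achieves it, both with maximum-likelihood decoding and
    -- with decoders that anticipate a single joint type
    (∀ P ∈ stdSimplex ℝ X, EcP W P R K = Ec W R K →
      Tendsto (fun n : ℕ => ((expo n (1 - PeRandom W R K P n) : ℝ) : EReal))
        atTop (𝓝 (Ec W R K)) ∧
      ∃ τ : ℕ → X × Y → ℕ, (∀ n, ∑ z, τ n z = n) ∧
        (∀ᶠ n in atTop, 0 < 1 - PeRandomType W R K P n (τ n)) ∧
        Tendsto (fun n : ℕ => ((expo n (1 - PeRandomType W R K P n (τ n)) : ℝ) : EReal))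
          atTop (𝓝 (Ec W R K))) := by
  have hleast := isLeast_EcP hW R K
  obtain ⟨Q, hQ, hmin⟩ := exists_jointObj_min hW R K
  refine ⟨(Ec_eq_of_isMin hW R K hQ hmin).2, fun P hP => ?_, hleast, ?_, fun P hP hEP => ?_⟩
  · obtain ⟨Q', hQ', hmin'⟩ := exists_jointObjP_min hW hP R K
    exact (EcP_eq_of_isMin hP R K hQ' hmin').2
  · obtain ⟨P, hP, hEP⟩ := hleast.1
    obtain ⟨E, lo, hi, τ, hE, hlo, hhi, -, hb⟩ := exists_exponent_bounds hW hR hK hP hEP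
    rw [hE]
    refine tendsto_of_tendsto_of_tendsto_of_le_of_le' (EReal.tendsto_coe.2 hlo)
      (EReal.tendsto_coe.2 hhi) ?_ ?_
    · filter_upwards [eventually_ne_atTop 0] with n hn
      exact le_iInf fun C => EReal.coe_le_coe_iff.2 ((hb n hn).2.2 C)
    · filter_upwards [eventually_ne_atTop 0] with n hn
      obtain ⟨hpos, hle, -⟩ := hb n hn
      obtain ⟨C, hC⟩ := exists_one_sub_avgErrProb_le (W := W)
        (φ := mlDecoder X Y n (expSize n R) (expSize n K)) hP
      -- Some codebook under maximum likelihood does at least as well as the average type decoder,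
      -- whose exponent is at most `hi n`.
      refine iInf_le_of_le C (EReal.coe_le_coe_iff.2 (le_trans (expo_anti n hpos ?_) hle))
      exact (sub_le_sub_left (PeRandom_le_PeRandomType hR hK hW hP (τ n)) 1).trans hC
  · obtain ⟨E, lo, hi, τ, hE, hlo, hhi, hτ, hb⟩ := exists_exponent_bounds hW hR hK hP hEP
    rw [hE]
    -- The converse concerns single codebooks; it transfers to averages through a codebook that is
    -- at least as good as the average.
    have hlow : ∀ n, n ≠ 0 → ∀ p : ℝ, 0 < p → p ≤ 1 - PeRandom W R K P n → lo n ≤ expo n p := by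
      intro n hn p hp hpn
      obtain ⟨C, hC⟩ := exists_one_sub_avgErrProb_le (W := W)
        (φ := mlDecoder X Y n (expSize n R) (expSize n K)) hP
      exact ((hb n hn).2.2 C).trans (expo_anti n hp (hpn.trans hC))
    have hmono : ∀ n, 1 - PeRandomType W R K P n (τ n) ≤ 1 - PeRandom W R K P n := fun n =>
      sub_le_sub_left (PeRandom_le_PeRandomType hR hK hW hP (τ n)) 1
    refine ⟨EReal.tendsto_coe.2 (tendsto_of_tendsto_of_tendsto_of_le_of_le' hlo hhi ?_ ?_), τ, hτ,
      ?_, EReal.tendsto_coe.2 (tendsto_of_tendsto_of_tendsto_of_le_of_le' hlo hhi ?_ ?_)⟩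
    · filter_upwards [eventually_ne_atTop 0] with n hn
      exact hlow n hn _ ((hb n hn).1.trans_le (hmono n)) le_rfl
    · filter_upwards [eventually_ne_atTop 0] with n hn
      exact (expo_anti n (hb n hn).1 (hmono n)).trans (hb n hn).2.1
    · filter_upwards [eventually_ne_atTop 0] with n hn
      exact (hb n hn).1
    · filter_upwards [eventually_ne_atTop 0] with n hn
      exact hlow n hn _ (hb n hn).1 (hmono n)
    · filter_upwards [eventually_ne_atTop 0] with n hn
      exact (hb n hn).2.1
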